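/- Let $\mathbb K=\mathbb R$ or $\mathbb C$ and let $E$, $F$ be normed spaces over $\mathbb K$ (not necessarily complete). Suppose that one of the following holds. (a) $X$ and $Y$ are realcompact (completely regular Hausdorff) spaces, $E$ and $F$ are infinite-dimensional, and $A(X,E)=C_b(X,E)$, $A(Y,F)=C_b(Y,F)$ are the spaces of bounded continuous functions. (b) $X$ and $Y$ are complete metric spaces, $E\neq\{0\}$, $F\ne\{0\}$, and $A(X,E)=C_b^u(X,E)$, $A(Y,F)=C_b^u(Y,F)$ are the spaces of bounded uniformly continuous functions. Give $A(X,E)$ and $A(Y,F)$ the sup norm, and let $T:A(X,E)\to A(Y,F)$ be a continuous linear biseparating map, that is, $T$ is a continuous linear bijection such that $f,g\in A(X,E)$ have disjoint cozero sets $\{f\neq0\}$, $\{g\ne 0\}$ if and only if $Tf$ and $Tg$ have disjoint cozero sets. Then there are a homeomorphism $h$ from $Y$ onto $X$ (in case (b), one such that $h$ and $h^{-1}$ are uniformly continuous) and a map $J$ from $Y$ to the set of all (not necessarily continuous) bijective linear maps $E\to F$ such that $$(Tf)(y)=(Jy)\bigl(f(h(y))\bigr)\qquad\text{for all } f\in A(X,E),\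 y\in Y.$$ Moreover, for every homeomorphism $h$ from $Y$ onto $X$ and every such map $J$ satisfying this identity, $J$ takes values in the set $B(E,F)$ of continuous bijective linear maps $E\to F$, and $J:Y\to B(E,F)$ is continuous when $B(E,F)$ carries the strong operator topology, i.e. the coarsest topology for which $A\mapsto A\mathbf e$ is continuous for every $\mathbf e\in E$. -/

import Mathlib

open scoped BoundedContinuousFunction

/-- A space is realcompact if every real maximal ideal of `C(X, ℝ)` is fixed; equivalently, every
unital algebra homomorphism `C(X, ℝ) → ℝ` (the quotient maps by the real maximal ideals) is the
evaluation at a point of `X`. It is only used for completely regular Hausdorff spaces. -/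
class RealcompactSpace (X : Type*) [TopologicalSpace X] : Prop where
  exists_eval : ∀ φ : C(X, ℝ) →ₐ[ℝ] ℝ, ∃ x : X, ∀ f : C(X, ℝ), φ f = f x

/-- The space `C_b^u(X, E)` of bounded uniformly continuous functions, as a linear subspace of
`C_b(X, E) = X →ᵇ E`; as such it carries the sup norm. -/
def BddUniformCont (𝕜 X E : Type*) [RCLike 𝕜] [MetricSpace X] [NormedAddCommGroup E]
    [NormedSpace 𝕜 E] : Submodule 𝕜 (X →ᵇ E) where
  carrier := {f | UniformContinuous f}
  add_mem' := fun {f g} (hf : UniformContinuous f) (hg : UniformContinuous g) => by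
    show UniformContinuous (f + g)
    exact hf.add hg
  zero_mem' := by
    show UniformContinuous (fun _ : X => (0 : E))
    exact uniformContinuous_const
  smul_mem' := fun c f (hf : UniformContinuous f) => by
    show UniformContinuous (c • f)
    exact hf.const_smul c

instance BddUniformCont.instFunLike (𝕜 X E : Type*) [RCLike 𝕜] [MetricSpace X]
    [NormedAddCommGroup E] [NormedSpace 𝕜 E] : FunLike (BddUniformCont 𝕜 X E) X E where
  coe f := ((f : X →ᵇ E) : X → E)
  coe_injective := fun _ _ h => Subtype.ext (DFunLike.coe_injective h)

/-- A map between spaces of vector-valued functions is separating if it is additive and maps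
functions with disjoint cozero sets to functions with disjoint cozero sets.
(`Function.support f` is the cozero set `{x | f x ≠ 0}`; no closure is taken.) -/
structure IsSeparating {A B X Y E F : Type*} [Add A] [Add B] [Zero E] [Zero F]
    [FunLike A X E] [FunLike B Y F] (T : A → B) : Prop where
  map_add : ∀ f g : A, T (f + g) = T f + T g
  disjoint : ∀ f g : A, Disjoint (Function.support f) (Function.support g) →
    Disjoint (Function.support (T f)) (Function.support (T g))

/-- A map is biseparating if it is bijective and both it and its inverse are separating. -/
structure IsBiseparating {A B X Y E F : Type*} [Add A] [Add B] [Zero E] [Zero F]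
    [FunLike A X E] [FunLike B Y F] (T : A → B) : Prop where
  bijective : Function.Bijective T
  separating : IsSeparating T
  inverse_separating : IsSeparating (Equiv.ofBijective T bijective).symm

/-- `B(E, F)`: the continuous bijective linear maps from `E` to `F`
(the inverse is not required to be continuous). -/
def ContBij (𝕜 E F : Type*) [RCLike 𝕜] [NormedAddCommGroup E] [NormedSpace 𝕜 E]
    [NormedAddCommGroup F] [NormedSpace 𝕜 F] : Type _ :=
  {A : E →L[𝕜] F // Function.Bijective A}

/-- `B(E, F)` carries the strong operator topology: the coarsest topology for which
`A ↦ A e` is continuous for every `e : E`. -/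
instance ContBij.instTopologicalSpace (𝕜 E F : Type*) [RCLike 𝕜] [NormedAddCommGroup E]
    [NormedSpace 𝕜 E] [NormedAddCommGroup F] [NormedSpace 𝕜 F] :
    TopologicalSpace (ContBij 𝕜 E F) :=
  ⨅ e : E, TopologicalSpace.induced (fun A : ContBij 𝕜 E F => A.1 e) inferInstance

/-- `(T f)(y) = (J y)(f (h y))` for all `f` and `y`, where `J` takes values in the set
`B'(E, F)` of all (not necessarily continuous) bijective linear maps from `E` to `F`. -/
def IsRepresentedBy {𝕜 A B X Y E F : Type*} [RCLike 𝕜] [NormedAddCommGroup E] [NormedSpace 𝕜 E]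
    [NormedAddCommGroup F] [NormedSpace 𝕜 F] [FunLike A X E] [FunLike B Y F]
    (T : A → B) (h : Y → X) (J : Y → (E ≃ₗ[𝕜] F)) : Prop :=
  ∀ (f : A) (y : Y), T f y = J y (f (h y))

/-- `J` takes values in `B(E, F)` and is continuous as a map from `Y` to `B(E, F)` with the
strong operator topology. -/
def IsContinuousIntoContBij {𝕜 Y E F : Type*} [RCLike 𝕜] [NormedAddCommGroup E] [NormedSpace 𝕜 E]
    [NormedAddCommGroup F] [NormedSpace 𝕜 F] [TopologicalSpace Y] (J : Y → (E ≃ₗ[𝕜] F)) : Prop :=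
  ∃ J' : Y → ContBij 𝕜 E F, (∀ (y : Y) (e : E), (J' y).1 e = J y e) ∧ Continuous J'

/-! ### Function modules and disjointness-preserving bijections -/

open Set Filter Topology Function

/-! Both cases run through one abstract real function space `V` with bounded scalar multipliers `M`.
Disjointness makes `T` local: `T f` at `y` depends only on `f` along `germFilter T y`, whose basic
sets are the points where preimages of functions supported near `y` do not vanish
(`map_eq_of_eventuallyEq`). Cutting the preimage of a constant with functions of `a ∈ M` shows that
every multiplier converges along this filter (`exists_tendsto_germFilter`). It remains to see that
the filter converges to a point of `X`.

In the complete metric case the filter is countably generated; if it were not Cauchy, Efremovich's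
lemma would yield a bounded uniformly continuous function without a limit. In the realcompact case
it suffices that no positive bounded `u` tends to `0` along the filter
(`not_tendsto_germFilter_zero`): then every function in `C(X, ℝ)` has a limit, and the limits form a
character. Infinite dimension enters here. Preimages of constants are glued over the dyadic levels
`u ≈ 2⁻ᵐ`. If the limits of their norms are bounded over a ball of `F`, a separated sequence in that
ball glues to a bounded continuous function whose image oscillates at `y`. If not, constants tending
to `0` with growing preimages are glued on `Y`, and the result has an unbounded preimage.

The limit points give `h`, and those of the inverse give `h⁻¹`. Boundedness of `T` sharpens
locality: `T f` at `y` depends on the value `f (h y)` alone (`map_eq_zero_of_bounded`), so `J y e`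
is the value at `y` of the image of the constant `e`. The inverse of `T` is not known to be bounded,
so injectivity of `J y` needs its own argument, division by `√‖g‖` (`eq_zero_of_map_const_eq_zero`).
Continuity of `J` follows by testing on constants. -/

/-- A space `V` of continuous bounded functions, stable under multiplication by the functions of
`M`, and rich enough to separate points from closed sets. -/
structure IsFunctionModule {X E : Type*} [TopologicalSpace X] [NormedAddCommGroup E]
    [NormedSpace ℝ E] (V : Submodule ℝ (X → E)) (M : Set (X → ℝ)) : Prop where
  continuous_of_mem : ∀ f ∈ V, Continuous f
  bounded_of_mem : ∀ f ∈ V, ∃ C : ℝ, ∀ x, ‖f x‖ ≤ C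
  mul_continuous : ∀ a ∈ M, Continuous a
  mul_bounded : ∀ a ∈ M, ∃ C : ℝ, ∀ x, |a x| ≤ C
  smul_mem : ∀ a ∈ M, ∀ f ∈ V, (fun x => a x • f x) ∈ V
  comp_mem : ∀ a ∈ M, ∀ ψ : ℝ → ℝ, Continuous ψ → (fun x => ψ (a x)) ∈ M
  norm_mem : ∀ f ∈ V, (fun x => ‖f x‖) ∈ M
  exists_bump : ∀ (U : Set X), IsOpen U → ∀ x ∈ U, ∃ a ∈ M, a x = 1 ∧ ∀ z ∉ U, a z = 0
  const_mem : ∀ e : E, (fun _ => e) ∈ V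
  limit_mem : ∀ f : X → E, (∀ ε > 0, ∃ f' ∈ V, ∀ x, ‖f x - f' x‖ ≤ ε) → f ∈ V

/-- A linear bijection preserving disjointness of cozero sets in both directions. -/
def PreservesDisjointness {X Y E F : Type*} [NormedAddCommGroup E] [NormedSpace ℝ E]
    [NormedAddCommGroup F] [NormedSpace ℝ F] {V : Submodule ℝ (X → E)} {W : Submodule ℝ (Y → F)}
    (T : V ≃ₗ[ℝ] W) : Prop :=
  ∀ f g : V, Disjoint (support (f : X → E)) (support (g : X → E)) ↔
    Disjoint (support (T f : Y → F)) (support (T g : Y → F))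

theorem PreservesDisjointness.symm {X Y E F : Type*} [NormedAddCommGroup E] [NormedSpace ℝ E]
    [NormedAddCommGroup F] [NormedSpace ℝ F] {V : Submodule ℝ (X → E)} {W : Submodule ℝ (Y → F)}
    {T : V ≃ₗ[ℝ] W} (hT : PreservesDisjointness T) : PreservesDisjointness T.symm := by
  intro f g
  have := hT (T.symm f) (T.symm g)
  simpa using this.symm

section Module

variable {X E : Type*} [TopologicalSpace X] [NormedAddCommGroup E] [NormedSpace ℝ E]
  {V : Submodule ℝ (X → E)} {M : Set (X → ℝ)}

theorem IsFunctionModule.isOpen_support (hV : IsFunctionModule V M) (f : V) :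
    IsOpen (support (f : X → E)) :=
  (hV.continuous_of_mem _ f.2).isOpen_support

theorem IsFunctionModule.exists_supported [Nontrivial E] (hV : IsFunctionModule V M) {U : Set X}
    {x : X} (hU : U ∈ 𝓝 x) : ∃ f : V, support (f : X → E) ⊆ U ∧ (f : X → E) x ≠ 0 := by
  obtain ⟨O, hOU, hO, hx⟩ := mem_nhds_iff.1 hU
  obtain ⟨a, haM, hax, ha⟩ := hV.exists_bump O hO x hx
  obtain ⟨e, he⟩ := exists_ne (0 : E)
  refine ⟨⟨_, hV.smul_mem a haM _ (hV.const_mem e)⟩, ?_, by simp [hax, he]⟩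
  intro z hz
  by_contra hzU
  exact hz (by simp [ha z fun h => hzU (hOU h)])

end Module

/-! ### Germ filters and locality -/

section Germ

variable {X Y E F : Type*} [NormedAddCommGroup E] [NormedSpace ℝ E] [NormedAddCommGroup F]
  [NormedSpace ℝ F] {V : Submodule ℝ (X → E)} {W : Submodule ℝ (Y → F)}

/-- The points at which the preimage of some function supported in `s` does not vanish. -/
def germSet (T : V ≃ₗ[ℝ] W) (s : Set Y) : Set X :=
  {x | ∃ g : W, support (g : Y → F) ⊆ s ∧ (T.symm g : X → E) x ≠ 0}

theorem germSet_mono (T : V ≃ₗ[ℝ] W) : Monotone (germSet T) :=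
  fun _ _ hst _ ⟨g, hg, hx⟩ => ⟨g, hg.trans hst, hx⟩

/-- The filter on `X` along which the functions of `V` determine their images at `y`. -/
def germFilter [TopologicalSpace Y] (T : V ≃ₗ[ℝ] W) (y : Y) : Filter X := (𝓝 y).lift' (germSet T)

theorem mem_germFilter [TopologicalSpace Y] {T : V ≃ₗ[ℝ] W} {y : Y} {s : Set X} :
    s ∈ germFilter T y ↔ ∃ t ∈ 𝓝 y, germSet T t ⊆ s :=
  mem_lift'_sets (germSet_mono T)

theorem eventually_germFilter_of_open [TopologicalSpace Y] {T : V ≃ₗ[ℝ] W} {y : Y} {s : Set X}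
    (h : s ∈ germFilter T y) : ∀ᶠ z in 𝓝 y, s ∈ germFilter T z := by
  obtain ⟨t, ht, hs⟩ := mem_germFilter.1 h
  filter_upwards [eventually_mem_nhds_iff.2 ht] with z hz
  exact mem_germFilter.2 ⟨t, hz, hs⟩

variable [TopologicalSpace Y] {N : Set (Y → ℝ)}

theorem germFilter_neBot [Nontrivial F] (hW : IsFunctionModule W N) (T : V ≃ₗ[ℝ] W) (y : Y) :
    (germFilter T y).NeBot := by
  refine ⟨fun h => ?_⟩
  obtain ⟨t, ht, hs⟩ := mem_germFilter.1 (h ▸ mem_bot : (∅ : Set X) ∈ germFilter T y)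
  obtain ⟨g, hg, hy⟩ := hW.exists_supported ht
  have h0 : T.symm g ≠ 0 := by
    intro h0
    rw [LinearEquiv.map_eq_zero_iff] at h0
    exact hy (by simp [h0])
  have : ∃ x, (T.symm g : X → E) x ≠ 0 := by
    by_contra! hc
    exact h0 (Subtype.ext (funext hc))
  obtain ⟨x, hx⟩ := this
  exact hs ⟨g, hg, hx⟩

/-- Where `T f` does not vanish, the cozero set of `f` meets every set of the germ filter. -/
theorem exists_ne_zero_of_eventually (hW : IsFunctionModule W N) {T : V ≃ₗ[ℝ] W} (hT : PreservesDisjointness T) {f : V} {y : Y}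
    (hy : (T f : Y → F) y ≠ 0) {p : X → Prop} (hp : ∀ᶠ x in germFilter T y, p x) :
    ∃ x, (f : X → E) x ≠ 0 ∧ p x := by
  obtain ⟨t, ht, hs⟩ := mem_germFilter.1 hp
  obtain ⟨O, hOt, hO, hyO⟩ := mem_nhds_iff.1 ht
  obtain ⟨a, haN, hay, ha⟩ := hW.exists_bump O hO y hyO
  let g : W := ⟨_, hW.smul_mem a haN _ (T f).2⟩
  have hgy : (g : Y → F) y ≠ 0 := by simpa [g, hay] using hy
  have hgt : support (g : Y → F) ⊆ t := by
    intro z hz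
    by_contra hzt
    exact hz (by simp [g, ha z fun h => hzt (hOt h)])
  have hgf : ¬ Disjoint (support (g : Y → F)) (support (T f : Y → F)) :=
    fun hd => Set.disjoint_left.1 hd hgy hy
  have h1 : ¬ Disjoint (support (T.symm g : X → E)) (support (f : X → E)) := by
    rw [hT]; simpa using hgf
  obtain ⟨x, hx, hxf⟩ := Set.not_disjoint_iff.1 h1
  exact ⟨x, hxf, hs ⟨g, hgt, hx⟩⟩

theorem map_eq_zero_of_eventually (hW : IsFunctionModule W N) {T : V ≃ₗ[ℝ] W} (hT : PreservesDisjointness T) {f : V} {y : Y}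
    (hf : ∀ᶠ x in germFilter T y, (f : X → E) x = 0) : (T f : Y → F) y = 0 := by
  by_contra hy
  obtain ⟨x, hx, hx0⟩ := exists_ne_zero_of_eventually hW hT hy hf
  exact hx hx0

theorem map_eq_of_eventuallyEq (hW : IsFunctionModule W N) {T : V ≃ₗ[ℝ] W} (hT : PreservesDisjointness T) {f f' : V} {y : Y}
    (hf : ∀ᶠ x in germFilter T y, (f : X → E) x = (f' : X → E) x) :
    (T f : Y → F) y = (T f' : Y → F) y := by
  have := map_eq_zero_of_eventually hW hT (f := f - f') (y := y)
    (hf.mono fun x hx => by simp [hx])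
  simpa [sub_eq_zero] using this

end Germ

/-! ### Limits of multipliers along germ filters, and the point map -/

section Core

variable {X Y E F : Type*} [TopologicalSpace X] [TopologicalSpace Y]
  [NormedAddCommGroup E] [NormedSpace ℝ E] [NormedAddCommGroup F] [NormedSpace ℝ F]
  {V : Submodule ℝ (X → E)} {W : Submodule ℝ (Y → F)} {M : Set (X → ℝ)} {N : Set (Y → ℝ)}

/-- Cutting `T f` down to a point outside the closure gives `g` disjoint from `T f'`. Its preimage
misses the cozero set of `f'` and, being nonzero on an open set, also the closure, hence misses `f`,
although `g` meets `T f`. -/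
theorem support_map_subset_closure (hV : IsFunctionModule V M) (hW : IsFunctionModule W N)
    {T : V ≃ₗ[ℝ] W} (hT : PreservesDisjointness T) {f f' : V}
    (h : support (f : X → E) ⊆ closure (support (f' : X → E))) :
    support (T f : Y → F) ⊆ closure (support (T f' : Y → F)) := by
  intro y hy
  by_contra hyc
  obtain ⟨a, haN, hay, ha⟩ := hW.exists_bump _ isClosed_closure.isOpen_compl y hyc
  let g : W := ⟨_, hW.smul_mem a haN _ (T f).2⟩
  have h1 : Disjoint (support (g : Y → F)) (support (T f' : Y → F)) := by
    rw [Set.disjoint_left]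
    intro z hz hz'
    exact hz (by simp [g, ha z fun hc => hc (subset_closure hz')])
  have h2 : Disjoint (support (T.symm g : X → E)) (support (f' : X → E)) := by
    rw [hT]; simpa using h1
  have h3 : Disjoint (support (T.symm g : X → E)) (support (f : X → E)) :=
    (h2.closure_right (hV.isOpen_support _)).mono_right h
  rw [hT] at h3
  have hgy : (g : Y → F) y ≠ 0 := by simpa [g, hay] using hy
  simp only [LinearEquiv.apply_symm_apply] at h3
  exact Set.disjoint_left.1 h3 hgy hy

/-- A function with image supported in the cozero set of `T f₁` and cozero set disjoint from that
of `f₁` vanishes. -/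
theorem eq_zero_of_disjoint_of_support_subset (hV : IsFunctionModule V M)
    (hW : IsFunctionModule W N) {T : V ≃ₗ[ℝ] W} (hT : PreservesDisjointness T) {f₁ f f' : V}
    (hf : support (T f : Y → F) ⊆ support (T f₁ : Y → F))
    (hf' : support (f' : X → E) ⊆ support (f : X → E))
    (hd : Disjoint (support (f' : X → E)) (support (f₁ : X → E))) : f' = 0 := by
  have h1 : support (T f' : Y → F) ⊆ closure (support (T f₁ : Y → F)) :=
    (support_map_subset_closure hV hW hT (hf'.trans subset_closure)).trans (closure_mono hf)
  have h2 := ((hT _ _).1 hd).closure_right (hW.isOpen_support _)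
  have h3 : support (T f' : Y → F) = ∅ := by
    rw [← bot_eq_empty, ← disjoint_self]
    exact h2.mono_right h1
  have : T f' = 0 := Subtype.ext (support_eq_empty_iff.1 h3)
  simpa using this

/-- The preimage of a nonzero constant splits into `f₁`, living on `a < m'`, and `f₂`, living on `a
> m`. Their images have nonzero sum, so one of them is nonzero at `y`, and the germ filter then
avoids the region where the corresponding piece is cut off. -/
theorem eventually_le_or_eventually_ge [Nontrivial F] (hV : IsFunctionModule V M)
    (hW : IsFunctionModule W N) {T : V ≃ₗ[ℝ] W} (hT : PreservesDisjointness T) (y : Y)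
    {a : X → ℝ} (ha : a ∈ M) {m m' : ℝ} (hm : m < m') :
    (∀ᶠ x in germFilter T y, a x ≤ m') ∨ ∀ᶠ x in germFilter T y, m ≤ a x := by
  obtain ⟨w, hw⟩ := exists_ne (0 : F)
  let f₀ : V := T.symm ⟨_, hW.const_mem w⟩
  let ψ : ℝ → ℝ := fun r => max 0 (min 1 ((m' - r) / (m' - m)))
  have hψ : Continuous ψ := by fun_prop
  let f₁ : V := ⟨_, hV.smul_mem _ (hV.comp_mem a ha ψ hψ) _ f₀.2⟩
  let f₂ : V := ⟨_, hV.smul_mem _ (hV.comp_mem a ha (fun r => 1 - ψ r) (by fun_prop)) _ f₀.2⟩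
  have hsum : f₁ + f₂ = f₀ := by
    ext x
    simp only [f₁, f₂, Submodule.coe_add, Pi.add_apply, ← add_smul]
    simp
  have hTsum : (T f₁ : Y → F) y + (T f₂ : Y → F) y = w := by
    have : T f₁ + T f₂ = T f₀ := by rw [← map_add, hsum]
    have := congrArg (fun g : W => (g : Y → F) y) this
    simpa [f₀] using this
  -- `θ ∘ a` marks a region where `f₁` vanishes. Multiplying by it a preimage of a function
  -- supported in the cozero set of `T f₁` gives something disjoint from `f₁`, hence `0`.
  have key : ∀ (f₁ : V) (θ : ℝ → ℝ), Continuous θ → (T f₁ : Y → F) y ≠ 0 →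
      (∀ x, θ (a x) ≠ 0 → (f₁ : X → E) x = 0) → ∀ᶠ x in germFilter T y, θ (a x) = 0 := by
    intro f₁ θ hθ hy hd
    refine mem_germFilter.2 ⟨support (T f₁ : Y → F), (hW.isOpen_support _).mem_nhds hy, ?_⟩
    rintro x ⟨g, hg, hx⟩
    let f' : V := ⟨_, hV.smul_mem _ (hV.comp_mem a ha θ hθ) _ (T.symm g).2⟩
    have hf' : f' = 0 := by
      refine eq_zero_of_disjoint_of_support_subset hV hW hT (f₁ := f₁) (f := T.symm g)
        (by simpa using hg) ?_ ?_
      · intro z hz hz0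
        exact hz (by simp [f', hz0])
      · rw [Set.disjoint_left]
        intro z hz hz'
        refine hz' (hd z fun h => hz ?_)
        simp [f', h]
    have := congrArg (fun g : V => (g : X → E) x) hf'
    simpa [f', hx] using this
  have hpos : 0 < m' - m := sub_pos.2 hm
  by_cases h1 : (T f₁ : Y → F) y = 0
  · right
    have h2 : (T f₂ : Y → F) y ≠ 0 := by
      rw [h1, zero_add] at hTsum
      rwa [hTsum]
    refine (key f₂ (fun r => max 0 (m - r)) (by fun_prop) h2 fun x hx => ?_).mono
      fun x (hx : max 0 (m - a x) = 0) => ?_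
    · have hax : a x < m := by
        by_contra! h
        exact hx (max_eq_left (by linarith))
      have : 1 ≤ (m' - a x) / (m' - m) := by rw [le_div_iff₀ hpos]; linarith
      simp [f₂, ψ, min_eq_left this]
    · have := le_max_right 0 (m - a x)
      linarith
  · left
    refine (key f₁ (fun r => max 0 (r - m')) (by fun_prop) h1 fun x hx => ?_).mono
      fun x (hx : max 0 (a x - m') = 0) => ?_
    · have hax : m' < a x := by
        by_contra! h
        exact hx (max_eq_left (by linarith))
      have : (m' - a x) / (m' - m) ≤ 0 := div_nonpos_of_nonpos_of_nonneg (by linarith) hpos.le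
      have h0 : ψ (a x) = 0 := max_eq_left ((min_le_right _ _).trans this)
      simp [f₁, h0]
    · have := le_max_right 0 (a x - m')
      linarith

theorem exists_tendsto_germFilter [Nontrivial F] (hV : IsFunctionModule V M)
    (hW : IsFunctionModule W N) {T : V ≃ₗ[ℝ] W} (hT : PreservesDisjointness T) (y : Y)
    {a : X → ℝ} (ha : a ∈ M) : ∃ r, Tendsto a (germFilter T y) (𝓝 r) := by
  have := germFilter_neBot hW T y
  obtain ⟨C, hC⟩ := hV.mul_bounded a ha
  have hmem : Icc (-C) C ∈ map a (germFilter T y) :=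
    Filter.mem_map.2 (univ_mem' fun x => abs_le.1 (hC x))
  obtain ⟨r, -, hr⟩ := isCompact_Icc.exists_clusterPt (le_principal_iff.2 hmem)
  have huniq : ∀ s t, s < t → ClusterPt s (map a (germFilter T y)) →
      ClusterPt t (map a (germFilter T y)) → False := by
    intro s t hst hs ht
    obtain ⟨m, hsm, hmt⟩ := exists_between hst
    obtain ⟨m', hmm', hmt'⟩ := exists_between hmt
    rcases eventually_le_or_eventually_ge hV hW hT y ha hmm' with h | h
    · have := (clusterPt_iff_frequently.1 ht) _ (Ioi_mem_nhds hmt')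
      obtain ⟨x, hx, hx'⟩ := ((frequently_map.1 this).and_eventually h).exists
      exact absurd hx' (not_le.2 hx)
    · have := (clusterPt_iff_frequently.1 hs) _ (Iio_mem_nhds hsm)
      obtain ⟨x, hx, hx'⟩ := ((frequently_map.1 this).and_eventually h).exists
      exact absurd hx' (not_le.2 hx)
  refine ⟨r, isCompact_Icc.le_nhds_of_unique_clusterPt hmem fun s _ hs => ?_⟩
  rcases lt_trichotomy s r with h | h | h
  · exact (huniq _ _ h hs hr).elim
  · exact h
  · exact (huniq _ _ h hr hs).elim

/-- The transport of a scalar function on `X` to `Y`. -/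
noncomputable def transport (T : V ≃ₗ[ℝ] W) (a : X → ℝ) (y : Y) : ℝ := limUnder (germFilter T y) a

theorem tendsto_transport [Nontrivial F] (hV : IsFunctionModule V M)
    (hW : IsFunctionModule W N) {T : V ≃ₗ[ℝ] W} (hT : PreservesDisjointness T) (y : Y)
    {a : X → ℝ} (ha : a ∈ M) : Tendsto a (germFilter T y) (𝓝 (transport T a y)) :=
  have := germFilter_neBot hW T y
  tendsto_nhds_limUnder (exists_tendsto_germFilter hV hW hT y ha)

theorem continuous_transport [Nontrivial F] (hV : IsFunctionModule V M)
    (hW : IsFunctionModule W N) {T : V ≃ₗ[ℝ] W} (hT : PreservesDisjointness T)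
    {a : X → ℝ} (ha : a ∈ M) : Continuous (transport T a) := by
  rw [continuous_iff_continuousAt]
  intro y
  refine (closed_nhds_basis _).tendsto_right_iff.2 fun s hs => ?_
  have := tendsto_transport hV hW hT y ha hs.1
  filter_upwards [eventually_germFilter_of_open this] with z hz
  have := germFilter_neBot hW T z
  exact hs.2.mem_of_tendsto (tendsto_transport hV hW hT z ha) hz

theorem transport_mem_of_isClosed [Nontrivial F] (hV : IsFunctionModule V M)
    (hW : IsFunctionModule W N) {T : V ≃ₗ[ℝ] W} (hT : PreservesDisjointness T) (y : Y)
    {a : X → ℝ} (ha : a ∈ M) {f : V} (hy : (T f : Y → F) y ≠ 0) {s : Set ℝ} (hs : IsClosed s)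
    (hf : ∀ x, (f : X → E) x ≠ 0 → a x ∈ s) : transport T a y ∈ s := by
  by_contra hc
  obtain ⟨x, hx, hxs⟩ := exists_ne_zero_of_eventually hW hT hy
    (tendsto_transport hV hW hT y ha (hs.isOpen_compl.mem_nhds hc))
  exact hxs (hf x hx)

/-- This stands in for the point maps being mutually inverse before they are known to exist. -/
theorem tendsto_transport_symm [Nontrivial F] (hV : IsFunctionModule V M)
    (hW : IsFunctionModule W N) {T : V ≃ₗ[ℝ] W} (hT : PreservesDisjointness T) (x : X)
    {a : X → ℝ} (ha : a ∈ M) :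
    Tendsto (transport T a) (germFilter T.symm x) (𝓝 (a x)) := by
  refine (closed_nhds_basis _).tendsto_right_iff.2 fun s hs => ?_
  refine mem_germFilter.2 ⟨a ⁻¹' s, (hV.mul_continuous a ha).continuousAt hs.1, ?_⟩
  rintro y ⟨f, hf, hy⟩
  exact transport_mem_of_isClosed hV hW hT y ha hy hs.2 fun z hz => hf hz

theorem continuous_of_germFilter_le [Nontrivial F] [RegularSpace X]
    (hW : IsFunctionModule W N) {T : V ≃ₗ[ℝ] W} {h : Y → X}
    (hh : ∀ y, germFilter T y ≤ 𝓝 (h y)) : Continuous h := by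
  rw [continuous_iff_continuousAt]
  intro y
  refine (closed_nhds_basis _).tendsto_right_iff.2 fun s hs => ?_
  filter_upwards [eventually_germFilter_of_open (hh y hs.1)] with z hz
  have := germFilter_neBot hW T z
  exact hs.2.mem_of_tendsto (tendsto_id'.2 (hh z)) hz

/-- If `k (h y) ≠ y`, separate them by `Q` and `P`. Some `x` with `k x ∈ Q` has a nonzero value of a
preimage of some `g` supported in `P`; locality of the inverse at `x` makes `g` nonzero somewhere in
`Q`. -/
theorem leftInverse_of_germFilter_le [Nontrivial E] [Nontrivial F] [T2Space Y]
    (hV : IsFunctionModule V M) (hW : IsFunctionModule W N) {T : V ≃ₗ[ℝ] W}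
    (hT : PreservesDisjointness T) {h : Y → X} {k : X → Y}
    (hh : ∀ y, germFilter T y ≤ 𝓝 (h y)) (hk : ∀ x, germFilter T.symm x ≤ 𝓝 (k x))
    (hkc : Continuous k) : LeftInverse k h := by
  intro y
  by_contra hne
  obtain ⟨Q, P, hQ, hP, hyQ, hyP, hd⟩ := t2_separation hne
  have h1 : k ⁻¹' Q ∈ germFilter T y := hh y (hkc.continuousAt (hQ.mem_nhds hyQ))
  have h2 : germSet T P ∈ germFilter T y := mem_germFilter.2 ⟨P, hP.mem_nhds hyP, le_rfl⟩
  have := germFilter_neBot hW T y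
  obtain ⟨x, hxQ, g, hg, hx⟩ := Filter.nonempty_of_mem (inter_mem h1 h2)
  obtain ⟨z, hz, hzQ⟩ := exists_ne_zero_of_eventually hV hT.symm hx
    (hk x (hQ.mem_nhds hxQ))
  exact Set.disjoint_left.1 hd hzQ (hg hz)

end Core

/-! ### The two concrete function modules -/

/-- The bounded continuous functions as a space of functions. -/
def boundedContinuous (X E : Type*) [TopologicalSpace X] [NormedAddCommGroup E]
    [NormedSpace ℝ E] : Submodule ℝ (X → E) where
  carrier := {f | Continuous f ∧ ∃ C : ℝ, ∀ x, ‖f x‖ ≤ C}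
  add_mem' := by
    rintro f g ⟨hf, C, hC⟩ ⟨hg, D, hD⟩
    exact ⟨hf.add hg, C + D, fun x => norm_add_le_of_le (hC x) (hD x)⟩
  zero_mem' := ⟨continuous_const, 0, fun x => by simp⟩
  smul_mem' := by
    rintro c f ⟨hf, C, hC⟩
    refine ⟨hf.const_smul c, ‖c‖ * C, fun x => ?_⟩
    rw [Pi.smul_apply, norm_smul]
    exact mul_le_mul_of_nonneg_left (hC x) (norm_nonneg c)

/-- The bounded uniformly continuous functions as a space of functions. -/
def boundedUniform (X E : Type*) [PseudoMetricSpace X] [NormedAddCommGroup E]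
    [NormedSpace ℝ E] : Submodule ℝ (X → E) where
  carrier := {f | UniformContinuous f ∧ ∃ C : ℝ, ∀ x, ‖f x‖ ≤ C}
  add_mem' := by
    rintro f g ⟨hf, C, hC⟩ ⟨hg, D, hD⟩
    exact ⟨hf.add hg, C + D, fun x => norm_add_le_of_le (hC x) (hD x)⟩
  zero_mem' := ⟨uniformContinuous_const, 0, fun x => by simp⟩
  smul_mem' := by
    rintro c f ⟨hf, C, hC⟩
    refine ⟨hf.const_smul c, ‖c‖ * C, fun x => ?_⟩
    rw [Pi.smul_apply, norm_smul]
    exact mul_le_mul_of_nonneg_left (hC x) (norm_nonneg c)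

theorem exists_bound_comp {X : Type*} {a : X → ℝ} (ha : ∃ C : ℝ, ∀ x, ‖a x‖ ≤ C) {ψ : ℝ → ℝ}
    (hψ : Continuous ψ) : ∃ C : ℝ, ∀ x, ‖ψ (a x)‖ ≤ C := by
  obtain ⟨C, hC⟩ := ha
  obtain ⟨D, hD⟩ := (isCompact_Icc (a := -C) (b := C)).exists_bound_of_continuousOn
    hψ.continuousOn
  exact ⟨D, fun x => hD _ (abs_le.1 (hC x))⟩

theorem exists_bound_smul {X E : Type*} [NormedAddCommGroup E] [NormedSpace ℝ E] {a : X → ℝ}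
    {f : X → E} (ha : ∃ C : ℝ, ∀ x, ‖a x‖ ≤ C) (hf : ∃ C : ℝ, ∀ x, ‖f x‖ ≤ C) :
    ∃ C : ℝ, ∀ x, ‖a x • f x‖ ≤ C := by
  obtain ⟨C, hC⟩ := ha
  obtain ⟨D, hD⟩ := hf
  refine ⟨C * D, fun x => ?_⟩
  rw [norm_smul]
  exact mul_le_mul (hC x) (hD x) (norm_nonneg _) ((norm_nonneg _).trans (hC x))

theorem exists_bound_of_approx {X E : Type*} [NormedAddCommGroup E] {f f' : X → E}
    (hf' : ∃ C : ℝ, ∀ x, ‖f' x‖ ≤ C) {r : ℝ} (h : ∀ x, ‖f x - f' x‖ ≤ r) :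
    ∃ C : ℝ, ∀ x, ‖f x‖ ≤ C := by
  obtain ⟨C, hC⟩ := hf'
  refine ⟨r + C, fun x => ?_⟩
  simpa using norm_add_le_of_le (h x) (hC x)

theorem isFunctionModule_boundedContinuous (X E : Type*) [TopologicalSpace X]
    [CompletelyRegularSpace X] [NormedAddCommGroup E] [NormedSpace ℝ E] :
    IsFunctionModule (boundedContinuous X E) (boundedContinuous X ℝ : Set (X → ℝ)) where
  continuous_of_mem f hf := hf.1
  bounded_of_mem f hf := hf.2
  mul_continuous a ha := ha.1
  mul_bounded a ha := ha.2
  smul_mem a ha f hf := ⟨ha.1.smul hf.1, exists_bound_smul ha.2 hf.2⟩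
  comp_mem a ha ψ hψ := ⟨hψ.comp ha.1, exists_bound_comp ha.2 hψ⟩
  norm_mem f hf := ⟨hf.1.norm, by simpa using hf.2⟩
  exists_bump U hU x hx := by
    obtain ⟨f, hf, hfx, hf1⟩ := CompletelyRegularSpace.completely_regular x Uᶜ
      hU.isClosed_compl (by simpa using hx)
    refine ⟨fun z => 1 - f z, ⟨by fun_prop, 1, fun z => ?_⟩, by simp [hfx], fun z hz => ?_⟩
    · rw [Real.norm_eq_abs, abs_le]
      constructor <;> linarith [(f z).2.1, (f z).2.2]
    · have : f z = 1 := hf1 hz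
      simp [this]
  const_mem e := ⟨continuous_const, ‖e‖, fun _ => le_rfl⟩
  limit_mem f hf := by
    refine ⟨continuous_of_uniform_approx_of_continuous fun u hu => ?_, ?_⟩
    · obtain ⟨ε, hε, h⟩ := Metric.mem_uniformity_dist.1 hu
      obtain ⟨f', hf', hd⟩ := hf (ε / 2) (by positivity)
      refine ⟨f', hf'.1, fun x => h ?_⟩
      rw [dist_eq_norm]
      exact (hd x).trans_lt (by linarith)
    · obtain ⟨f', hf', hd⟩ := hf 1 one_pos
      exact exists_bound_of_approx hf'.2 hd

theorem uniformContinuous_smul_of_bounded {X E : Type*} [PseudoMetricSpace X]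
    [NormedAddCommGroup E] [NormedSpace ℝ E] {a : X → ℝ} {f : X → E}
    (ha : UniformContinuous a) (hf : UniformContinuous f) (hab : ∃ C : ℝ, ∀ x, ‖a x‖ ≤ C)
    (hfb : ∃ C : ℝ, ∀ x, ‖f x‖ ≤ C) : UniformContinuous fun x => a x • f x := by
  obtain ⟨C, hC⟩ := hab
  obtain ⟨D, hD⟩ := hfb
  rw [Metric.uniformContinuous_iff] at ha hf ⊢
  intro ε hε
  obtain ⟨δ, hδ, h1⟩ := ha (ε / 2 / (|D| + 1)) (by positivity)
  obtain ⟨δ', hδ', h2⟩ := hf (ε / 2 / (|C| + 1)) (by positivity)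
  refine ⟨min δ δ', lt_min hδ hδ', fun x z hxz => ?_⟩
  have h1 := h1 (hxz.trans_le (min_le_left _ _))
  have h2 := h2 (hxz.trans_le (min_le_right _ _))
  rw [dist_eq_norm, lt_div_iff₀ (by positivity)] at h1 h2
  have heq : a x • f x - a z • f z = (a x - a z) • f x + a z • (f x - f z) := by
    rw [sub_smul, smul_sub]; abel
  rw [dist_eq_norm, heq]
  refine (norm_add_le _ _).trans_lt ?_
  rw [norm_smul, norm_smul]
  have h3 : ‖a x - a z‖ * ‖f x‖ ≤ ‖a x - a z‖ * (|D| + 1) := by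
    gcongr
    linarith [hD x, le_abs_self D]
  have h4 : ‖a z‖ * ‖f x - f z‖ ≤ ‖f x - f z‖ * (|C| + 1) := by
    rw [mul_comm]
    gcongr
    linarith [hC z, le_abs_self C]
  linarith

theorem isFunctionModule_boundedUniform (X E : Type*) [PseudoMetricSpace X]
    [NormedAddCommGroup E] [NormedSpace ℝ E] :
    IsFunctionModule (boundedUniform X E) (boundedUniform X ℝ : Set (X → ℝ)) where
  continuous_of_mem f hf := hf.1.continuous
  bounded_of_mem f hf := hf.2
  mul_continuous a ha := ha.1.continuous
  mul_bounded a ha := ha.2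
  smul_mem a ha f hf :=
    ⟨uniformContinuous_smul_of_bounded ha.1 hf.1 ha.2 hf.2, exists_bound_smul ha.2 hf.2⟩
  comp_mem a ha ψ hψ := by
    refine ⟨?_, exists_bound_comp ha.2 hψ⟩
    obtain ⟨C, hC⟩ := ha.2
    have := isCompact_Icc (a := -C) (b := C).uniformContinuousOn_of_continuous hψ.continuousOn
    rw [← uniformContinuousOn_univ]
    exact this.comp ha.1.uniformContinuousOn fun x _ => abs_le.1 (hC x)
  norm_mem f hf := ⟨uniformContinuous_norm.comp hf.1, by simpa using hf.2⟩
  exists_bump U hU x hx := by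
    obtain ⟨ε, hε, h⟩ := Metric.isOpen_iff.1 hU x hx
    refine ⟨fun z => max 0 (1 - ε⁻¹ * dist z x), ⟨?_, 1, fun z => ?_⟩, by simp, fun z hz => ?_⟩
    · have h1 : UniformContinuous fun z => 1 - ε⁻¹ * dist z x :=
        uniformContinuous_const.sub
          ((uniformContinuous_id.dist uniformContinuous_const).const_smul ε⁻¹)
      exact (LipschitzWith.id.const_max 0).uniformContinuous.comp h1
    · rw [Real.norm_eq_abs, abs_of_nonneg (le_max_left _ _)]
      have : 0 ≤ ε⁻¹ * dist z x := by positivity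
      exact max_le zero_le_one (by linarith)
    · have h1 : ε ≤ dist z x := by
        by_contra! hlt
        exact hz (h hlt)
      refine max_eq_left ?_
      have : 1 ≤ ε⁻¹ * dist z x := by
        rw [inv_mul_eq_div, le_div_iff₀ hε]; linarith
      linarith
  const_mem e := ⟨uniformContinuous_const, ‖e‖, fun _ => le_rfl⟩
  limit_mem f hf := by
    refine ⟨uniformContinuous_of_uniform_approx_of_uniformContinuous fun u hu => ?_, ?_⟩
    · obtain ⟨ε, hε, h⟩ := Metric.mem_uniformity_dist.1 hu
      obtain ⟨f', hf', hd⟩ := hf (ε / 2) (by positivity)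
      refine ⟨f', hf'.1, fun x => h ?_⟩
      rw [dist_eq_norm]
      exact (hd x).trans_lt (by linarith)
    · obtain ⟨f', hf', hd⟩ := hf 1 one_pos
      exact exists_bound_of_approx hf'.2 hd

/-! ### Separating sequences by uniformly continuous functions -/

/-- Efremovich's lemma: two sequences whose terms of equal index stay apart have subsequences
that stay apart. -/
theorem exists_subseq_forall_le_dist {X : Type*} [PseudoMetricSpace X] {x x' : ℕ → X} {δ : ℝ}
    (hδ : 0 < δ) (h : ∀ n, 4 * δ ≤ dist (x n) (x' n)) :
    ∃ φ : ℕ → ℕ, StrictMono φ ∧ ∀ m n, δ ≤ dist (x (φ m)) (x' (φ n)) := by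
  -- If one sequence returns infinitely often to a `δ`-ball, keep those terms: they are within `2δ`
  -- of each other and the gap `4δ` does the rest.
  by_cases h1 : ∃ z, ∃ᶠ n in atTop, dist (x n) z < δ
  · obtain ⟨z, hz⟩ := h1
    obtain ⟨φ, hφ, hd⟩ := extraction_of_frequently_atTop hz
    refine ⟨φ, hφ, fun m n => ?_⟩
    linarith [dist_triangle4 (x (φ n)) z (x (φ m)) (x' (φ n)), hd n, hd m, h (φ n),
      dist_comm z (x (φ m))]
  by_cases h2 : ∃ z, ∃ᶠ n in atTop, dist (x' n) z < δ
  · obtain ⟨z, hz⟩ := h2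
    obtain ⟨φ, hφ, hd⟩ := extraction_of_frequently_atTop hz
    refine ⟨φ, hφ, fun m n => ?_⟩
    linarith [dist_triangle4 (x (φ m)) (x' (φ n)) z (x' (φ m)), hd n, hd m, h (φ m),
      dist_comm z (x' (φ m))]
  -- Now both sequences eventually leave every `δ`-ball, so indices can be chosen greedily, each
  -- avoiding the finitely many earlier terms.
  simp only [not_exists, not_frequently, not_lt] at h1 h2
  obtain ⟨φ, -, hφ⟩ := exists_seq_of_forall_finset_exists (fun _ : ℕ => True)
    (fun n m => n < m ∧ δ ≤ dist (x m) (x' n) ∧ δ ≤ dist (x' m) (x n)) fun s _ => by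
      have : ∀ᶠ m in atTop, ∀ n ∈ s, n < m ∧ δ ≤ dist (x m) (x' n) ∧ δ ≤ dist (x' m) (x n) :=
        (eventually_all_finset s).2 fun n _ => (eventually_gt_atTop n).and ((h1 _).and (h2 _))
      obtain ⟨m, hm⟩ := this.exists
      exact ⟨m, trivial, hm⟩
  refine ⟨φ, fun m n hmn => (hφ m n hmn).1, fun m n => ?_⟩
  rcases lt_trichotomy m n with hmn | rfl | hmn
  · rw [dist_comm]
    exact (hφ m n hmn).2.2
  · linarith [h (φ m)]
  · exact (hφ n m hmn).2.1

theorem exists_subseq_separated {X : Type*} [PseudoMetricSpace X] {x x' : ℕ → X} {ε : ℝ}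
    (hε : 0 < ε) (h : ∀ n, ε ≤ dist (x n) (x' n)) :
    ∃ φ : ℕ → ℕ, StrictMono φ ∧ ∃ q ∈ boundedUniform X ℝ,
      ∀ n, (∀ᶠ z in 𝓝 (x (φ n)), q z = 1) ∧ ∀ᶠ z in 𝓝 (x' (φ n)), q z = 0 := by
  obtain ⟨φ, hφ, hd⟩ := exists_subseq_forall_le_dist (x := x) (x' := x') (δ := ε / 4) (by positivity)
    (fun n => by linarith [h n])
  refine ⟨φ, hφ, ?_⟩
  set δ := ε / 4
  have hδ : 0 < δ := by positivity
  set A := range (x ∘ φ)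
  have hA : A.Nonempty := range_nonempty _
  have hc : Continuous fun z => Metric.infDist z A := Metric.continuous_infDist_pt A
  -- Equal to `1` within `δ / 3` of `A` and to `0` beyond `2 * δ / 3`: constancy on neighbourhoods
  -- is what locality requires.
  refine ⟨fun z => max 0 (min 1 (2 - 3 / δ * Metric.infDist z A)), ⟨?_, 1, fun z => ?_⟩,
    fun n => ⟨?_, ?_⟩⟩
  · have h1 : UniformContinuous fun z => 2 - 3 / δ * Metric.infDist z A :=
      uniformContinuous_const.sub ((Metric.uniformContinuous_infDist_pt A).const_smul (3 / δ))
    exact ((LipschitzWith.id.const_min 1).const_max 0).uniformContinuous.comp h1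
  · rw [Real.norm_eq_abs, abs_of_nonneg (le_max_left _ _)]
    exact max_le zero_le_one (min_le_left _ _)
  · have h0 : Metric.infDist (x (φ n)) A < δ / 3 := by
      rw [Metric.infDist_zero_of_mem (show x (φ n) ∈ A from mem_range_self n)]
      positivity
    filter_upwards [hc.continuousAt.eventually_lt_const h0] with z hz
    have : 3 / δ * Metric.infDist z A ≤ 1 := by
      rw [div_mul_eq_mul_div, div_le_one hδ]; linarith
    rw [min_eq_left (by linarith), max_eq_right zero_le_one]
  · have h0 : 2 * δ / 3 < Metric.infDist (x' (φ n)) A := by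
      refine lt_of_lt_of_le (by linarith) ((Metric.le_infDist hA).2 ?_ : δ ≤ _)
      rintro _ ⟨m, rfl⟩
      rw [dist_comm]
      exact hd m n
    filter_upwards [hc.continuousAt.eventually_const_lt h0] with z hz
    have : 2 ≤ 3 / δ * Metric.infDist z A := by
      rw [div_mul_eq_mul_div, le_div_iff₀ hδ]; linarith
    exact max_eq_left ((min_le_right _ _).trans (by linarith))

/-- Countable generation turns failure of the Cauchy property into two sequences converging along
`G` that stay `ε` apart; a function equal to `1` on one and `0` on the other, along a subsequence,
has no limit. -/
theorem exists_le_nhds_of_forall_tendsto {X : Type*} [PseudoMetricSpace X] [CompleteSpace X]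
    {G : Filter X} [G.NeBot] [G.IsCountablyGenerated]
    (h : ∀ a ∈ boundedUniform X ℝ, ∃ r, Tendsto a G (𝓝 r)) : ∃ x, G ≤ 𝓝 x := by
  refine CompleteSpace.complete (Metric.cauchy_iff.2 ⟨inferInstance, ?_⟩)
  by_contra! hc
  obtain ⟨ε, hε, hc⟩ := hc
  obtain ⟨B, hB⟩ := G.exists_antitone_basis
  choose x hx x' hx' hd using fun n => hc (B n) (hB.mem n)
  obtain ⟨φ, hφ, q, hq, hq'⟩ := exists_subseq_separated hε hd
  obtain ⟨r, hr⟩ := h q hq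
  have h1 := (hr.comp (hB.tendsto hx)).comp hφ.tendsto_atTop
  have h2 := (hr.comp (hB.tendsto hx')).comp hφ.tendsto_atTop
  have e1 : (q ∘ x) ∘ φ = fun _ => 1 := funext fun n => (hq' n).1.self_of_nhds
  have e2 : (q ∘ x') ∘ φ = fun _ => 0 := funext fun n => (hq' n).2.self_of_nhds
  rw [e1, tendsto_const_nhds_iff] at h1
  rw [e2, tendsto_const_nhds_iff] at h2
  exact one_ne_zero (h1.trans h2.symm)

/-! ### Uniform continuity of the point map, and dependence on point values -/

section Core

variable {X Y E F : Type*} [NormedAddCommGroup E] [NormedSpace ℝ E] [NormedAddCommGroup F]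
  [NormedSpace ℝ F]

theorem isCountablyGenerated_germFilter [TopologicalSpace Y] [FirstCountableTopology Y]
    {V : Submodule ℝ (X → E)} {W : Submodule ℝ (Y → F)} (T : V ≃ₗ[ℝ] W) (y : Y) :
    (germFilter T y).IsCountablyGenerated := by
  obtain ⟨B, hB⟩ := (𝓝 y).exists_antitone_basis
  have := hB.toHasBasis.lift' (germSet_mono T)
  exact HasCountableBasis.isCountablyGenerated ⟨this, to_countable _⟩

/-- Otherwise some `q` separates `h (y n)` from `h (y' n)` along a subsequence, and multiplying the
preimage of a constant `w ≠ 0` by `q` yields an image equal to `w` at `y n` and `0` at `y' n`,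
points arbitrarily close together. -/
theorem uniformContinuous_of_germFilter_le [PseudoMetricSpace X] [PseudoMetricSpace Y]
    [Nontrivial F] {T : boundedUniform X E ≃ₗ[ℝ] boundedUniform Y F}
    (hT : PreservesDisjointness T) {h : Y → X} (hh : ∀ y, germFilter T y ≤ 𝓝 (h y)) :
    UniformContinuous h := by
  have hV := isFunctionModule_boundedUniform X E
  have hW := isFunctionModule_boundedUniform Y F
  rw [Metric.uniformContinuous_iff]
  by_contra! hc
  obtain ⟨ε, hε, hc⟩ := hc
  choose y y' hd hε' using fun n : ℕ => hc (1 / ((n : ℝ) + 1)) (by positivity)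
  obtain ⟨φ, hφ, q, hq, hq'⟩ := exists_subseq_separated hε hε'
  obtain ⟨w, hw⟩ := exists_ne (0 : F)
  let f₀ : boundedUniform X E := T.symm ⟨_, hW.const_mem w⟩
  let f : boundedUniform X E := ⟨_, hV.smul_mem q hq _ f₀.2⟩
  have h1 : ∀ n, (T f : Y → F) (y (φ n)) = w := fun n => by
    rw [map_eq_of_eventuallyEq hW hT (f' := f₀)]
    · simp [f₀]
    · filter_upwards [hh _ (hq' n).1] with z (hz : q z = 1)
      simp [f, hz]
  have h2 : ∀ n, (T f : Y → F) (y' (φ n)) = 0 := fun n => by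
    refine map_eq_zero_of_eventually hW hT ?_
    filter_upwards [hh _ (hq' n).2] with z (hz : q z = 0)
    simp [f, hz]
  obtain ⟨δ, hδ, hu⟩ := Metric.uniformContinuous_iff.1 (T f).2.1 ‖w‖ (norm_pos_iff.2 hw)
  obtain ⟨n, hn⟩ := exists_nat_one_div_lt hδ
  have hle : 1 / ((φ n : ℝ) + 1) ≤ 1 / ((n : ℝ) + 1) := by
    have : (n : ℝ) ≤ φ n := by exact_mod_cast hφ.id_le n
    gcongr
  have := hu ((hd (φ n)).trans_le (hle.trans hn.le))
  rw [h1, h2, dist_zero_right] at this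
  exact lt_irrefl _ this

variable [TopologicalSpace X] [TopologicalSpace Y]
  {V : Submodule ℝ (X → E)} {W : Submodule ℝ (Y → F)} {M : Set (X → ℝ)} {N : Set (Y → ℝ)}

/-- Up to `2 * ε` in sup norm, `f` may be replaced by `f'` vanishing where `‖f‖ ≤ ε`, hence near `h
y`. Locality kills the image of `f'` at `y`, and boundedness controls the rest. -/
theorem map_eq_zero_of_bounded (hV : IsFunctionModule V M) (hW : IsFunctionModule W N)
    {T : V ≃ₗ[ℝ] W} (hT : PreservesDisjointness T) {h : Y → X}
    (hh : ∀ y, germFilter T y ≤ 𝓝 (h y)) {C : ℝ}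
    (hC : ∀ (f : V) (r : ℝ), 0 ≤ r → (∀ x, ‖(f : X → E) x‖ ≤ r) → ∀ y, ‖(T f : Y → F) y‖ ≤ C * r)
    {f : V} {y : Y} (hf : (f : X → E) (h y) = 0) : (T f : Y → F) y = 0 := by
  have key : ∀ ε > 0, ‖(T f : Y → F) y‖ ≤ C * (2 * ε) := by
    intro ε hε
    let ψ : ℝ → ℝ := fun t => max 0 (min 1 (t / ε - 1))
    have hψ : Continuous ψ := by fun_prop
    let f' : V := ⟨_, hV.smul_mem _ (hV.comp_mem _ (hV.norm_mem _ f.2) ψ hψ) _ f.2⟩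
    have h0 : (T f' : Y → F) y = 0 := by
      refine map_eq_zero_of_eventually hW hT ?_
      have hlt : ‖(f : X → E) (h y)‖ < ε := by simpa [hf] using hε
      filter_upwards [hh y ((hV.continuous_of_mem _ f.2).norm.continuousAt.eventually_lt_const
        hlt)] with x (hx : ‖(f : X → E) x‖ < ε)
      have hx' : ‖(f : X → E) x‖ / ε ≤ 1 := (div_le_one hε).2 hx.le
      have : ψ ‖(f : X → E) x‖ = 0 := max_eq_left ((min_le_right _ _).trans (by linarith))
      simp [f', this]
    have h1 := hC (f - f') (2 * ε) (by positivity) (fun x => ?_) y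
    · simpa [h0] using h1
    · have heq : ((f - f' : V) : X → E) x = (1 - ψ ‖(f : X → E) x‖) • (f : X → E) x := by
        simp [f', sub_smul]
      have hψ0 : 0 ≤ ψ ‖(f : X → E) x‖ := le_max_left _ _
      have hψ1 : ψ ‖(f : X → E) x‖ ≤ 1 := max_le zero_le_one (min_le_left _ _)
      rw [heq, norm_smul, Real.norm_eq_abs, abs_of_nonneg (by linarith)]
      by_cases hx : ‖(f : X → E) x‖ ≤ 2 * ε
      · nlinarith [norm_nonneg ((f : X → E) x)]
      · have : 1 ≤ ‖(f : X → E) x‖ / ε - 1 := by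
          have : 2 ≤ ‖(f : X → E) x‖ / ε := by rw [le_div_iff₀ hε]; linarith
          linarith
        have : ψ ‖(f : X → E) x‖ = 1 := by
          simp [ψ, min_eq_left this]
        rw [this]
        simp [hε.le]
  have hlim : Tendsto (fun ε : ℝ => C * (2 * ε)) (𝓝[>] 0) (𝓝 (C * (2 * 0))) :=
    ((continuous_const.mul (continuous_const.mul continuous_id)).tendsto 0).mono_left
      nhdsWithin_le_nhds
  have := ge_of_tendsto hlim (eventually_mem_nhdsWithin.mono key)
  simpa using this

theorem map_eq_map_of_bounded (hV : IsFunctionModule V M) (hW : IsFunctionModule W N)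
    {T : V ≃ₗ[ℝ] W} (hT : PreservesDisjointness T) {h : Y → X}
    (hh : ∀ y, germFilter T y ≤ 𝓝 (h y)) {C : ℝ}
    (hC : ∀ (f : V) (r : ℝ), 0 ≤ r → (∀ x, ‖(f : X → E) x‖ ≤ r) → ∀ y, ‖(T f : Y → F) y‖ ≤ C * r)
    {f f' : V} {y : Y} (hf : (f : X → E) (h y) = (f' : X → E) (h y)) :
    (T f : Y → F) y = (T f' : Y → F) y := by
  have := map_eq_zero_of_bounded hV hW hT hh hC (f := f - f') (y := y) (by simp [hf])
  simpa [sub_eq_zero] using this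

theorem IsFunctionModule.inv_sqrt_norm_smul_mem (hV : IsFunctionModule V M) (f : V) :
    (fun x => (√‖(f : X → E) x‖)⁻¹ • (f : X → E) x) ∈ V := by
  -- Replacing `‖f‖` by `max ‖f‖ (ε ^ 2)` under the root is a legitimate multiplier and costs at
  -- most `√‖f‖ < ε` where it matters.
  refine hV.limit_mem _ fun ε hε => ?_
  have hδ : 0 < ε ^ 2 := by positivity
  have hκ : Continuous fun t : ℝ => (√(max t (ε ^ 2)))⁻¹ :=
    (Real.continuous_sqrt.comp (continuous_id.max continuous_const)).inv₀ fun t =>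
      (Real.sqrt_pos.2 (lt_max_of_lt_right hδ)).ne'
  refine ⟨_, hV.smul_mem _ (hV.comp_mem _ (hV.norm_mem _ f.2) _ hκ) _ f.2, fun x => ?_⟩
  set n := ‖(f : X → E) x‖
  rcases le_or_gt (ε ^ 2) n with hn | hn
  · simp [max_eq_left hn, hε.le]
  · rw [max_eq_right hn.le, Real.sqrt_sq hε.le, ← sub_smul, norm_smul]
    rcases (norm_nonneg ((f : X → E) x)).eq_or_lt with h0 | h0
    · rw [← h0]; simp [hε.le]
    · have hs : 0 < √n := Real.sqrt_pos.2 h0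
      have hsε : √n < ε := (Real.sqrt_lt' hε).2 hn
      have h1 : ε⁻¹ ≤ (√n)⁻¹ := inv_anti₀ hs hsε.le
      rw [Real.norm_eq_abs, abs_of_nonneg (by linarith)]
      have h2 : (√n)⁻¹ * n = √n := by
        rw [inv_mul_eq_div, Real.div_sqrt]
      have h3 : 0 ≤ ε⁻¹ * n := by positivity
      change ((√n)⁻¹ - ε⁻¹) * n ≤ ε
      nlinarith

/-- The value at `y` of the image of a constant function determines the constant. -/
theorem eq_zero_of_map_const_eq_zero [Nontrivial E] [Nontrivial F]
    (hV : IsFunctionModule V M) (hW : IsFunctionModule W N) {T : V ≃ₗ[ℝ] W}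
    (hT : PreservesDisjointness T) {h : Y → X} {k : X → Y}
    (hh : ∀ y, germFilter T y ≤ 𝓝 (h y)) (hk : ∀ x, germFilter T.symm x ≤ 𝓝 (k x))
    (hkh : LeftInverse k h) (hNM : ∀ a ∈ N, a ∘ k ∈ M) {C : ℝ}
    (hC : ∀ (f : V) (r : ℝ), 0 ≤ r → (∀ x, ‖(f : X → E) x‖ ≤ r) → ∀ y, ‖(T f : Y → F) y‖ ≤ C * r)
    {e : E} {y₀ : Y} (he : (T ⟨_, hV.const_mem e⟩ : Y → F) y₀ = 0) : e = 0 := by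
  by_contra hne
  set g : W := T ⟨_, hV.const_mem e⟩ with hg
  have hgc : Continuous (g : Y → F) := hW.continuous_of_mem _ g.2
  -- The preimage of `g / √‖g‖` has the value `e / √‖g y‖` at `h y` wherever `g y ≠ 0`. Its bound
  -- `D` keeps the nonzero values of `g` away from `0`, so `g` vanishes near `y₀`, and locality of
  -- the inverse gives `e = 0`.
  let g' : W := ⟨_, hW.inv_sqrt_norm_smul_mem g⟩
  obtain ⟨D, hD⟩ := hV.bounded_of_mem _ (T.symm g').2
  have key : ∀ y, (g : Y → F) y ≠ 0 → ‖e‖ ≤ D * √‖(g : Y → F) y‖ := by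
    intro y hy
    set n := ‖(g : Y → F) y‖
    have hn : 0 < n := norm_pos_iff.2 hy
    have hκ : Continuous fun t : ℝ => (√(max t (n / 2)))⁻¹ :=
      (Real.continuous_sqrt.comp (continuous_id.max continuous_const)).inv₀ fun t =>
        (Real.sqrt_pos.2 (lt_max_of_lt_right (by positivity))).ne'
    have ha := hW.comp_mem _ (hW.norm_mem _ g.2) _ hκ
    set a : Y → ℝ := fun z => (√(max ‖(g : Y → F) z‖ (n / 2)))⁻¹ with ha_def
    let f₁ : V := ⟨_, hV.smul_mem _ (hNM a ha) _ (hV.const_mem e)⟩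
    have hTf₁ : T f₁ = ⟨_, hW.smul_mem a ha _ g.2⟩ := by
      ext z
      have h1 : (T f₁ : Y → F) z = (T (a z • ⟨_, hV.const_mem e⟩) : Y → F) z :=
        map_eq_map_of_bounded hV hW hT hh hC (by simp [f₁, hkh z])
      rw [h1, map_smul, ← hg]
      rfl
    have h2 : (T.symm g' : X → E) (h y) = (T.symm (T f₁) : X → E) (h y) := by
      refine map_eq_of_eventuallyEq hV hT.symm ?_
      have hlt : n / 2 < ‖(g : Y → F) y‖ := half_lt_self hn
      have := hgc.norm.continuousAt.eventually_const_lt hlt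
      rw [← hkh y] at this
      filter_upwards [hk _ this] with z (hz : n / 2 < ‖(g : Y → F) z‖)
      rw [hTf₁]
      simp [g', a, max_eq_left hz.le]
    have h3 : (f₁ : X → E) (h y) = (√n)⁻¹ • e := by
      simp only [f₁, comp_apply, hkh y, a]
      rw [max_eq_left (half_le_self hn.le)]
    have h4 := hD (h y)
    rw [h2, LinearEquiv.symm_apply_apply, h3, norm_smul, norm_inv, Real.norm_eq_abs,
      abs_of_nonneg (Real.sqrt_nonneg n), inv_mul_le_iff₀ (Real.sqrt_pos.2 hn)] at h4
    linarith
  have hlt : D * √‖(g : Y → F) y₀‖ < ‖e‖ := by simpa [he] using hne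
  have hev : ∀ᶠ y in 𝓝 y₀, D * √‖(g : Y → F) y‖ < ‖e‖ :=
    (continuous_const.mul hgc.norm.sqrt).continuousAt.eventually_lt_const hlt
  rw [← hkh y₀] at hev
  have h0 : (T.symm g : X → E) (h y₀) = 0 := by
    refine map_eq_zero_of_eventually hV hT.symm ?_
    filter_upwards [hk _ hev] with y (hy : D * √‖(g : Y → F) y‖ < ‖e‖)
    by_contra hgy
    exact absurd (key y hgy) (not_le.2 hy)
  simp [hg, hne] at h0

end Core

/-! ### Gluing along dyadic scales -/

/-- A continuous bump on the real line, equal to `1` on `[1/2, 11/10]` and to `0` off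
`(3/10, 6/5)`. -/
noncomputable def plateau (t : ℝ) : ℝ := max 0 (min 1 (min (5 * t - 3 / 2) (12 - 10 * t)))

theorem continuous_plateau : Continuous plateau := by
  unfold plateau; fun_prop

theorem abs_plateau_le (t : ℝ) : |plateau t| ≤ 1 := by
  rw [abs_of_nonneg (le_max_left _ _)]
  exact max_le zero_le_one (min_le_left _ _)

theorem plateau_eq_one {t : ℝ} (h : 1 / 2 ≤ t) (h' : t ≤ 11 / 10) : plateau t = 1 := by
  unfold plateau
  rw [min_eq_left (le_min (by linarith) (by linarith)), max_eq_right zero_le_one]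

theorem lt_of_plateau_ne_zero {t : ℝ} (h : plateau t ≠ 0) : 3 / 10 < t ∧ t < 6 / 5 := by
  constructor <;> by_contra! ht <;> refine h (max_eq_left ((min_le_right _ _).trans ?_))
  · exact (min_le_left _ _).trans (by linarith)
  · exact (min_le_right _ _).trans (by linarith)

/-- A set of natural numbers without consecutive elements. -/
def Sparse (I : Set ℕ) : Prop := ∀ m ∈ I, ∀ n ∈ I, m < n → m + 2 ≤ n

/-- The endpoints of `(3/10, 6/5)` have ratio exactly `4`, so scales at least two steps apart do not
overlap. -/
theorem Sparse.eq_of_plateau_ne_zero {I : Set ℕ} (hI : Sparse I) {m n : ℕ} (hm : m ∈ I)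
    (hn : n ∈ I) {t : ℝ} (h : plateau (2 ^ m * t) ≠ 0) (h' : plateau (2 ^ n * t) ≠ 0) :
    m = n := by
  have key : ∀ m ∈ I, ∀ n ∈ I, plateau (2 ^ m * t) ≠ 0 → plateau (2 ^ n * t) ≠ 0 →
      ¬ m < n := by
    intro m hm n hn h h' hlt
    have h1 := (lt_of_plateau_ne_zero h).1
    have h2 := (lt_of_plateau_ne_zero h').2
    obtain ⟨d, rfl⟩ := Nat.exists_eq_add_of_le (hI m hm n hn hlt)
    have hd : (1 : ℝ) ≤ 2 ^ d := one_le_pow₀ one_le_two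
    have : (2 : ℝ) ^ (m + 2 + d) * t = 4 * (2 ^ d * (2 ^ m * t)) := by ring
    rw [this] at h2
    nlinarith
  exact le_antisymm (not_lt.1 (key n hn m hm h' h)) (not_lt.1 (key m hm n hn h h'))

/-- The vectors `c m`, `m ∈ I`, glued along the dyadic scale of `t`. -/
noncomputable def dyadicSum {E : Type*} [NormedAddCommGroup E] [NormedSpace ℝ E] (I : Set ℕ)
    (t : ℝ) (c : ℕ → E) : E :=
  ∑ᶠ m, I.indicator (fun m => plateau (2 ^ m * t)) m • c m

section Dyadic

variable {E : Type*} [NormedAddCommGroup E] [NormedSpace ℝ E] {I : Set ℕ}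

theorem Sparse.dyadicSum_eq (hI : Sparse I) {t : ℝ} (c : ℕ → E) {m : ℕ} (hm : m ∈ I)
    (h : plateau (2 ^ m * t) ≠ 0) : dyadicSum I t c = plateau (2 ^ m * t) • c m := by
  rw [dyadicSum, finsum_eq_single _ m, indicator_of_mem hm]
  intro n hnm
  by_cases hn : n ∈ I
  · rw [indicator_of_mem hn]
    by_contra hne
    exact hnm (hI.eq_of_plateau_ne_zero hn hm (left_ne_zero_of_smul hne) h)
  · rw [indicator_of_notMem hn, zero_smul]

theorem Sparse.dyadicSum_eq_of_mem (hI : Sparse I) {t : ℝ} (c : ℕ → E) {m : ℕ} (hm : m ∈ I)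
    (h : 1 / 2 ≤ 2 ^ m * t) (h' : 2 ^ m * t ≤ 11 / 10) : dyadicSum I t c = c m := by
  have := plateau_eq_one h h'
  rw [hI.dyadicSum_eq c hm (by simp [this]), this, one_smul]

theorem dyadicSum_eq_zero {t : ℝ} (c : ℕ → E) (h : ∀ m ∈ I, plateau (2 ^ m * t) = 0) :
    dyadicSum I t c = 0 := by
  refine finsum_eq_zero_of_forall_eq_zero fun m => ?_
  by_cases hm : m ∈ I
  · rw [indicator_of_mem hm, h m hm, zero_smul]
  · rw [indicator_of_notMem hm, zero_smul]

theorem Sparse.norm_dyadicSum_le (hI : Sparse I) {t : ℝ} {c : ℕ → E} {C : ℝ} (hC : 0 ≤ C)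
    (h : ∀ m ∈ I, plateau (2 ^ m * t) ≠ 0 → ‖c m‖ ≤ C) : ‖dyadicSum I t c‖ ≤ C := by
  by_cases hz : ∀ m ∈ I, plateau (2 ^ m * t) = 0
  · rw [dyadicSum_eq_zero c hz, norm_zero]
    exact hC
  · push Not at hz
    obtain ⟨m, hm, hz⟩ := hz
    rw [hI.dyadicSum_eq c hm hz, norm_smul, Real.norm_eq_abs]
    have := mul_le_mul (abs_plateau_le (2 ^ m * t)) (h m hm hz) (norm_nonneg _) zero_le_one
    linarith

/-- Positivity gives local finiteness: where `u > u x / 2`, all large `m` drop out. -/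
theorem continuous_dyadicSum {X : Type*} [TopologicalSpace X] {u : X → ℝ} (hu : Continuous u)
    (hpos : ∀ x, 0 < u x) {f : ℕ → X → E} (hf : ∀ m, Continuous (f m)) :
    Continuous fun x => dyadicSum I (u x) fun m => f m x := by
  unfold dyadicSum
  refine continuous_finsum (fun m => ?_) fun x => ?_
  · by_cases hm : m ∈ I
    · simp only [indicator_of_mem hm]
      exact (continuous_plateau.comp (continuous_const.mul hu)).smul (hf m)
    · simp only [indicator_of_notMem hm, zero_smul]
      exact continuous_const
  · refine ⟨{z | u x / 2 < u z}, hu.continuousAt.eventually_const_lt (half_lt_self (hpos x)), ?_⟩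
    obtain ⟨K, hK⟩ := pow_unbounded_of_one_lt (6 / 5 / (u x / 2)) one_lt_two
    refine (finite_lt_nat K).subset ?_
    rintro m ⟨z, hz, hxz : u x / 2 < u z⟩
    by_contra! hKm
    have hKm : K ≤ m := not_lt.1 hKm
    have hm : m ∈ I := by
      by_contra hm
      exact hz (by simp [indicator_of_notMem hm])
    have h1 : plateau (2 ^ m * u z) ≠ 0 := by
      intro h0
      exact hz (by simp [indicator_of_mem hm, h0])
    have h2 := (lt_of_plateau_ne_zero h1).2
    have hx2 : 0 < u x / 2 := half_pos (hpos x)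
    rw [div_lt_iff₀ hx2] at hK
    have h3 : (2 : ℝ) ^ K ≤ 2 ^ m := pow_le_pow_right₀ one_le_two hKm
    have h4 : (2 : ℝ) ^ K * (u x / 2) ≤ 2 ^ m * u z :=
      mul_le_mul h3 hxz.le hx2.le (by positivity)
    linarith

/-- As `v` may vanish, local finiteness is lost. At most one term is nonzero at each point, so the
decay of `w` makes the partial sums converge uniformly. -/
theorem Sparse.dyadicSum_mem {Y : Type*} [TopologicalSpace Y] (hI : Sparse I)
    {W : Submodule ℝ (Y → E)} {N : Set (Y → ℝ)} (hW : IsFunctionModule W N) {v : Y → ℝ}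
    (hv : v ∈ N) {w : ℕ → E} (hw : ∀ m, ‖w m‖ ≤ 1 / ((m : ℝ) + 1)) :
    (fun y => dyadicSum I (v y) w) ∈ W := by
  refine hW.limit_mem _ fun ε hε => ?_
  obtain ⟨K, hK⟩ := exists_nat_one_div_lt hε
  refine ⟨∑ m ∈ Finset.range K,
    fun y => I.indicator (fun m => plateau (2 ^ m * v y)) m • w m,
    Submodule.sum_mem _ fun m _ => ?_, fun y => ?_⟩
  · by_cases hm : m ∈ I
    · simp only [indicator_of_mem hm]
      exact hW.smul_mem _ (hW.comp_mem v hv (fun t => plateau (2 ^ m * t))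
        (continuous_plateau.comp (continuous_const.mul continuous_id))) _ (hW.const_mem (w m))
    · simp only [indicator_of_notMem hm, zero_smul]
      exact W.zero_mem
  · rw [Finset.sum_apply]
    by_cases hz : ∀ m ∈ I, plateau (2 ^ m * v y) = 0
    · rw [dyadicSum_eq_zero w hz, Finset.sum_eq_zero, sub_zero, norm_zero]
      · exact hε.le
      · intro m _
        by_cases hm : m ∈ I
        · rw [indicator_of_mem hm, hz m hm, zero_smul]
        · rw [indicator_of_notMem hm, zero_smul]
    · push Not at hz
      obtain ⟨m, hm, hz⟩ := hz
      have hother : ∀ n, n ≠ m → I.indicator (fun m => plateau (2 ^ m * v y)) n • w n = 0 := by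
        intro n hnm
        by_cases hn : n ∈ I
        · rw [indicator_of_mem hn]
          by_contra hne
          exact hnm (hI.eq_of_plateau_ne_zero hn hm (left_ne_zero_of_smul hne) hz)
        · rw [indicator_of_notMem hn, zero_smul]
      rw [hI.dyadicSum_eq w hm hz]
      by_cases hmK : m < K
      · rw [Finset.sum_eq_single m (fun n _ hn => hother n hn)
          (fun h => absurd (Finset.mem_range.2 hmK) h), indicator_of_mem hm, sub_self, norm_zero]
        exact hε.le
      · rw [Finset.sum_eq_zero, sub_zero, norm_smul, Real.norm_eq_abs]
        · have h1 := mul_le_mul (abs_plateau_le (2 ^ m * v y)) (hw m) (norm_nonneg _) zero_le_one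
          have h2 : 1 / ((m : ℝ) + 1) ≤ 1 / ((K : ℝ) + 1) := by
            have : (K : ℝ) ≤ m := by exact_mod_cast not_lt.1 hmK
            gcongr
          linarith
        · intro n hn
          refine hother n fun h => hmK ?_
          rw [← h]
          exact Finset.mem_range.1 hn

end Dyadic

/-- A positive function tending to `0` can be enlarged so that its smallness forces the smallness
of countably many other functions tending to `0`. -/
theorem exists_pos_tendsto_zero_forall_lt_one {X : Type*} [TopologicalSpace X] {G : Filter X}
    {u : X → ℝ} (hu : u ∈ boundedContinuous X ℝ) (hpos : ∀ x, 0 < u x)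
    (hlim : Tendsto u G (𝓝 0)) {θ : ℕ → X → ℝ} (hθ : ∀ m, Continuous (θ m))
    (hθ0 : ∀ m x, 0 ≤ θ m x) (hθlim : ∀ m, Tendsto (θ m) G (𝓝 0)) :
    ∃ u' ∈ boundedContinuous X ℝ, (∀ x, 0 < u' x) ∧ Tendsto u' G (𝓝 0) ∧
      ∀ m x, u' x < 2 * (1 / 2) ^ m → θ m x < 1 := by
  let b : ℕ → ℝ := fun m => 2 * (1 / 2) ^ m
  have hb : Summable b := summable_geometric_two.mul_left 2
  have hb0 : ∀ m, 0 ≤ b m := fun m => by positivity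
  -- Adding these terms to `u` works because `θ m x ≥ 1` makes the `m`-th term equal to `b m`,
  -- forcing `u' x > b m`.
  let s : X → ℕ → ℝ := fun x m => b m * min 1 (θ m x)
  have hs0 : ∀ x m, 0 ≤ s x m := fun x m => mul_nonneg (hb0 m) (le_min zero_le_one (hθ0 m x))
  have hsb : ∀ x m, ‖s x m‖ ≤ b m := fun x m => by
    rw [Real.norm_eq_abs, abs_of_nonneg (hs0 x m)]
    exact mul_le_of_le_one_right (hb0 m) (min_le_left _ _)
  have hsum : ∀ x, Summable (s x) := fun x => hb.of_norm_bounded (hsb x)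
  have hcont : Continuous fun x => ∑' m, s x m :=
    continuous_tsum (fun m => by
      have := hθ m
      fun_prop) hb fun m x => hsb x m
  refine ⟨fun x => u x + ∑' m, s x m, ⟨hu.1.add hcont, ?_⟩, fun x => ?_, ?_, fun m x hx => ?_⟩
  · obtain ⟨C, hC⟩ := hu.2
    exact ⟨C + ∑' m, b m, fun x => norm_add_le_of_le (hC x)
      (tsum_of_norm_bounded hb.hasSum (hsb x))⟩
  · have : 0 ≤ ∑' m, s x m := tsum_nonneg (hs0 x)
    linarith [hpos x]
  · have h1 : Tendsto (fun x => ∑' m, s x m) G (𝓝 (∑' _ : ℕ, (0 : ℝ))) := by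
      refine tendsto_tsum_of_dominated_convergence hb (fun m => ?_)
        (Eventually.of_forall fun x m => hsb x m)
      have := ((tendsto_const_nhds (x := (1 : ℝ))).min (hθlim m)).const_mul (b m)
      simpa using this
    simpa using hlim.add h1
  · by_contra! hθx
    have h1 : b m ≤ ∑' m, s x m := by
      have := (hsum x).le_tsum m fun n _ => hs0 x n
      simpa [s, min_eq_left hθx] using this
    have h2 := hpos x
    change u x + ∑' m, s x m < b m at hx
    linarith

/-! ### Infinite dimension and realcompactness -/

section Bounded

variable {X Y E F : Type*} [TopologicalSpace X] [CompletelyRegularSpace X] [TopologicalSpace Y]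
  [CompletelyRegularSpace Y] [NormedAddCommGroup E] [NormedSpace ℝ E] [NormedAddCommGroup F]
  [NormedSpace ℝ F] {T : boundedContinuous X E ≃ₗ[ℝ] boundedContinuous Y F}

theorem transport_mem_boundedContinuous [Nontrivial F] (hT : PreservesDisjointness T) {a : X → ℝ}
    (ha : a ∈ boundedContinuous X ℝ) : transport T a ∈ boundedContinuous Y ℝ := by
  have hV := isFunctionModule_boundedContinuous X E
  have hW := isFunctionModule_boundedContinuous Y F
  obtain ⟨C, hC⟩ := ha.2
  refine ⟨continuous_transport hV hW hT ha, C, fun y => ?_⟩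
  have := germFilter_neBot hW T y
  exact le_of_tendsto' (tendsto_transport hV hW hT y ha).norm hC

/-- The transport may vanish at `y₀`, but along the inverse germ filter at any `x` it tends to `u x
> 0`. -/
theorem exists_transport_pos [Nontrivial F] (hT : PreservesDisjointness T) {u : X → ℝ}
    (hu : u ∈ boundedContinuous X ℝ) (hpos : ∀ x, 0 < u x) {y₀ : Y} {O : Set Y} (hO : O ∈ 𝓝 y₀) :
    ∃ y ∈ O, 0 < transport T u y := by
  have hV := isFunctionModule_boundedContinuous X E
  have hW := isFunctionModule_boundedContinuous Y F
  obtain ⟨g, hg, hy⟩ := hW.exists_supported hO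
  have : ∃ x, (T.symm g : X → E) x ≠ 0 := by
    by_contra! hc
    have h0 : T.symm g = 0 := Subtype.ext (funext hc)
    rw [LinearEquiv.map_eq_zero_iff] at h0
    exact hy (by simp [h0])
  obtain ⟨x, hx⟩ := this
  obtain ⟨y, hy, hvy⟩ := exists_ne_zero_of_eventually hV hT.symm hx
    ((tendsto_transport_symm hV hW hT x hu).eventually_const_lt (hpos x))
  exact ⟨y, hg hy, hvy⟩

/-- Every value in `(0, 1)` has a dyadic scale, even or odd. If both parities failed to accumulate
at `y₀`, some neighbourhood would contain no small positive value of the transport. -/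
theorem exists_sparse_scales [Nontrivial F] (hT : PreservesDisjointness T) {u : X → ℝ}
    (hu : u ∈ boundedContinuous X ℝ) (hpos : ∀ x, 0 < u x) {y₀ : Y}
    (h0 : Tendsto u (germFilter T y₀) (𝓝 0)) :
    ∃ I, Sparse I ∧ ∀ O ∈ 𝓝 y₀, ∀ ε > 0, ∃ y ∈ O, ∃ m ∈ I,
      transport T u y < ε ∧ 1 / 2 < 2 ^ m * transport T u y ∧ 2 ^ m * transport T u y ≤ 1 := by
  have hV := isFunctionModule_boundedContinuous X E
  have hW := isFunctionModule_boundedContinuous Y F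
  have := germFilter_neBot hW T y₀
  have hv0 : transport T u y₀ = 0 := tendsto_nhds_unique (tendsto_transport hV hW hT y₀ hu) h0
  by_contra! hc
  obtain ⟨O₁, hO₁, ε₁, hε₁, h₁⟩ := hc {m | Even m} fun m hm n hn hmn => by
    obtain ⟨a, rfl⟩ := hm
    obtain ⟨b, rfl⟩ := hn
    omega
  obtain ⟨O₂, hO₂, ε₂, hε₂, h₂⟩ := hc {m | Odd m} fun m hm n hn hmn => by
    obtain ⟨a, rfl⟩ := hm
    obtain ⟨b, rfl⟩ := hn
    omega
  have hev : ∀ᶠ y in 𝓝 y₀, transport T u y < min (min ε₁ ε₂) 1 :=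
    (continuous_transport hV hW hT hu).continuousAt.eventually_lt_const (by
      rw [hv0]; positivity)
  obtain ⟨y, ⟨⟨hy₁, hy₂⟩, hy⟩, hvy⟩ :=
    exists_transport_pos hT hu hpos (inter_mem (inter_mem hO₁ hO₂) hev)
  have hy : transport T u y < min (min ε₁ ε₂) 1 := hy
  simp only [lt_min_iff] at hy
  obtain ⟨m, hm, hm'⟩ := exists_nat_pow_near_of_lt_one hvy hy.2.le (by norm_num : (0 : ℝ) < 1 / 2)
    (by norm_num)
  rw [div_pow, one_pow, div_lt_iff₀ (by positivity), pow_succ] at hm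
  rw [div_pow, one_pow, le_div_iff₀ (by positivity)] at hm'
  have hm1 : 1 / 2 < 2 ^ m * transport T u y := by linarith
  have hm2 : 2 ^ m * transport T u y ≤ 1 := by linarith
  rcases Nat.even_or_odd m with he | ho
  · exact absurd hm2 (not_le.2 (h₁ y hy₁ m he hy.1.1 hm1))
  · exact absurd hm2 (not_le.2 (h₂ y hy₂ m ho hy.1.2 hm1))

/-- The glued `s` has image `w m` at points of scale `m`. Different scales occur arbitrarily near
`y₀`, so the separation of `w` contradicts continuity of `T s`. -/
theorem false_of_bounded_preimages [Nontrivial F] (hT : PreservesDisjointness T) {u : X → ℝ}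
    (hu : u ∈ boundedContinuous X ℝ) (hpos : ∀ x, 0 < u x) {y₀ : Y}
    (h0 : Tendsto u (germFilter T y₀) (𝓝 0)) {w : ℕ → F}
    (hw : Pairwise fun m n => 1 ≤ ‖w m - w n‖) {f : ℕ → boundedContinuous X E}
    (hf : ∀ m y, (T (f m) : Y → F) y = w m) {C : ℝ}
    (hC : ∀ m x, u x < 2 * (1 / 2) ^ m → ‖(f m : X → E) x‖ ≤ C) : False := by
  have hV := isFunctionModule_boundedContinuous X E
  have hW := isFunctionModule_boundedContinuous Y F
  obtain ⟨I, hI, hscale⟩ := exists_sparse_scales hT hu hpos h0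
  let s : boundedContinuous X E := ⟨fun x => dyadicSum I (u x) fun m => (f m : X → E) x,
    continuous_dyadicSum hu.1 hpos fun m => (f m).2.1, |C|, fun x =>
      hI.norm_dyadicSum_le (abs_nonneg C) fun m _ hm => (hC m x ?_).trans (le_abs_self C)⟩
  swap
  · have := (lt_of_plateau_ne_zero hm).2
    rw [div_pow, one_pow, mul_one_div, lt_div_iff₀ (by positivity)]
    linarith
  have hTs : ∀ y, ∀ m ∈ I, 1 / 2 < 2 ^ m * transport T u y → 2 ^ m * transport T u y ≤ 1 →
      (T s : Y → F) y = w m := by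
    intro y m hm h1 h2
    rw [← hf m y]
    refine map_eq_of_eventuallyEq hW hT ?_
    have hlim := (tendsto_transport hV hW hT y hu).const_mul (2 ^ m)
    -- The limit is only known to be at most `1`; the plateau extends to `11/10` to leave room for a
    -- strict bound.
    filter_upwards [hlim.eventually_const_lt h1,
      hlim.eventually_lt_const (show _ < (11 / 10 : ℝ) by linarith)] with x hx1 hx2
    exact hI.dyadicSum_eq_of_mem _ hm hx1.le hx2.le
  have hO : ∀ᶠ y in 𝓝 y₀, dist ((T s : Y → F) y) ((T s : Y → F) y₀) < 1 / 2 :=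
    (hW.continuous_of_mem _ (T s).2).continuousAt.eventually
      (Metric.ball_mem_nhds _ (by norm_num))
  obtain ⟨y₁, hy₁, m₁, hm₁, -, h1, h1'⟩ := hscale _ hO 1 one_pos
  have hv1 : 0 < transport T u y₁ := by
    by_contra! hneg
    nlinarith [pow_pos (two_pos (α := ℝ)) m₁]
  -- A value below a quarter of the first one cannot have the same scale.
  obtain ⟨y₂, hy₂, m₂, hm₂, hlt, h2, h2'⟩ := hscale _ hO (transport T u y₁ / 4) (by positivity)
  have hne : m₁ ≠ m₂ := by
    rintro rfl
    nlinarith [pow_pos (two_pos (α := ℝ)) m₁]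
  have hw : 1 ≤ ‖w m₁ - w m₂‖ := hw hne
  rw [← hTs y₁ m₁ hm₁ h1 h1', ← hTs y₂ m₂ hm₂ h2 h2', ← dist_eq_norm] at hw
  have hy₁ : dist ((T s : Y → F) y₁) ((T s : Y → F) y₀) < 1 / 2 := hy₁
  have hy₂ : dist ((T s : Y → F) y₂) ((T s : Y → F) y₀) < 1 / 2 := hy₂
  linarith [dist_triangle_right ((T s : Y → F) y₁) ((T s : Y → F) y₂) ((T s : Y → F) y₀)]

/-- Here the gluing takes place on `Y`. At scale `m` the preimage of the glued function agrees with
`f m`, of norm at least `m`, so it cannot be bounded. -/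
theorem false_of_unbounded_preimages [Nontrivial E] [Nontrivial F] (hT : PreservesDisjointness T)
    {u : X → ℝ} (hu : u ∈ boundedContinuous X ℝ) (hpos : ∀ x, 0 < u x) {y₀ : Y}
    (h0 : Tendsto u (germFilter T y₀) (𝓝 0)) {w : ℕ → F}
    (hw : ∀ m, ‖w m‖ ≤ 1 / ((m : ℝ) + 1)) {f : ℕ → boundedContinuous X E}
    (hf : ∀ m y, (T (f m) : Y → F) y = w m)
    (hC : ∀ m x, u x < 2 * (1 / 2) ^ m → m ≤ ‖(f m : X → E) x‖) : False := by
  have hV := isFunctionModule_boundedContinuous X E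
  have hW := isFunctionModule_boundedContinuous Y F
  obtain ⟨I, hI, hscale⟩ := exists_sparse_scales hT hu hpos h0
  let g : boundedContinuous Y F :=
    ⟨_, hI.dyadicSum_mem hW (transport_mem_boundedContinuous hT hu) hw⟩
  obtain ⟨D, hD⟩ := (T.symm g).2.2
  obtain ⟨K, hK⟩ := exists_nat_gt D
  obtain ⟨y, -, m, hm, hlt, h1, h2⟩ := hscale univ univ_mem ((1 / 2) ^ (K + 1)) (by positivity)
  have hKm : K < m := by
    by_contra! hle
    rw [div_pow, one_pow, lt_div_iff₀ (by positivity), pow_succ] at hlt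
    have h3 : (2 : ℝ) ^ m ≤ 2 ^ K := pow_le_pow_right₀ one_le_two hle
    have hv : 0 < transport T u y := by
      by_contra! hneg
      nlinarith [pow_pos (two_pos (α := ℝ)) m]
    nlinarith
  have hlim := (tendsto_transport hV hW hT y hu).const_mul (2 ^ m)
  have := germFilter_neBot hW T y
  obtain ⟨x, hx1, hx2⟩ := ((hlim.eventually_const_lt h1).and
    (hlim.eventually_lt_const (show _ < (11 / 10 : ℝ) by linarith))).exists
  have hgx : (T.symm g : X → E) x = (f m : X → E) x := by
    rw [← T.symm_apply_apply (f m)]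
    refine map_eq_of_eventuallyEq hV hT.symm ?_
    have hlim := (tendsto_transport_symm hV hW hT x hu).const_mul (2 ^ m)
    filter_upwards [hlim.eventually_const_lt hx1, hlim.eventually_lt_const hx2] with z hz1 hz2
    rw [hf]
    exact hI.dyadicSum_eq_of_mem _ hm hz1.le hz2.le
  have h4 := hC m x (by
    rw [div_pow, one_pow, mul_one_div, lt_div_iff₀ (by positivity)]
    linarith)
  rw [← hgx] at h4
  have h5 : (K : ℝ) < m := by exact_mod_cast hKm
  linarith [hD x]

/-- For an infinite-dimensional target, a positive bounded continuous function does not tend to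
`0` along a germ filter. -/
theorem not_tendsto_germFilter_zero [Nontrivial E] [Nontrivial F] (hT : PreservesDisjointness T)
    (hF : ∃ (R : ℝ) (w : ℕ → F), 1 < R ∧ (∀ n, ‖w n‖ ≤ R) ∧
      Pairwise fun m n => 1 ≤ ‖w m - w n‖)
    {u : X → ℝ} (hu : u ∈ boundedContinuous X ℝ) (hpos : ∀ x, 0 < u x) (y₀ : Y) :
    ¬ Tendsto u (germFilter T y₀) (𝓝 0) := by
  intro h0
  have hV := isFunctionModule_boundedContinuous X E
  have hW := isFunctionModule_boundedContinuous Y F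
  obtain ⟨R, w, hR, hwR, hw⟩ := hF
  let p : F → boundedContinuous X E := fun w => T.symm ⟨_, hW.const_mem w⟩
  have hp : ∀ w y, (T (p w) : Y → F) y = w := fun w y => by simp [p]
  have hlim : ∀ w, ∃ r, Tendsto (fun x => ‖(p w : X → E) x‖) (germFilter T y₀) (𝓝 r) :=
    fun w => exists_tendsto_germFilter hV hW hT y₀ (hV.norm_mem _ (p w).2)
  choose r hr using hlim
  by_cases hc : ∃ C, ∀ w, ‖w‖ ≤ R → r w ≤ C
  · obtain ⟨C, hC⟩ := hc
    obtain ⟨u', hu', hpos', hlim', hθ⟩ := exists_pos_tendsto_zero_forall_lt_one hu hpos h0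
      (θ := fun m x => max 0 (‖(p (w m) : X → E) x‖ - C))
      (fun m => by
        have := (p (w m)).2.1
        fun_prop) (fun m x => le_max_left _ _) (fun m => by
        have := (tendsto_const_nhds (x := (0 : ℝ))).max ((hr (w m)).sub_const C)
        rwa [max_eq_left (by linarith [hC _ (hwR m)])] at this)
    refine false_of_bounded_preimages hT hu' hpos' hlim' hw (fun m => hp (w m)) (C := C + 1)
      fun m x hx => ?_
    have := (le_max_right _ _).trans_lt (hθ m x hx)
    linarith
  · push Not at hc
    -- The factor `(m + 1) * R` is removed by `c m` to bring the constants below `1 / (m + 1)`; the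
    -- other `m + 1` remains as a lower bound for the limits of the preimages.
    choose w' hw' hrw using fun m : ℕ => hc (((m : ℝ) + 1) * (((m : ℝ) + 1) * R))
    have hR0 : 0 < R := by linarith
    let c : ℕ → ℝ := fun m => (((m : ℝ) + 1) * R)⁻¹
    have hc0 : ∀ m, 0 < c m := fun m => by positivity
    have hpc : ∀ m x, ‖(p (c m • w' m) : X → E) x‖ = c m * ‖(p (w' m) : X → E) x‖ := by
      intro m x
      have : p (c m • w' m) = c m • p (w' m) :=
        map_smul T.symm (c m) ⟨_, hW.const_mem (w' m)⟩
      rw [this, Submodule.coe_smul, Pi.smul_apply, norm_smul, Real.norm_eq_abs,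
        abs_of_pos (hc0 m)]
    obtain ⟨u', hu', hpos', hlim', hθ⟩ := exists_pos_tendsto_zero_forall_lt_one hu hpos h0
      (θ := fun m x => max 0 ((m : ℝ) + 1 - c m * ‖(p (w' m) : X → E) x‖))
      (fun m => by
        have := (p (w' m)).2.1
        fun_prop) (fun m x => le_max_left _ _) (fun m => by
        have := (tendsto_const_nhds (x := (0 : ℝ))).max
          (((hr (w' m)).const_mul (c m)).const_sub ((m : ℝ) + 1))
        have hlt : (m : ℝ) + 1 < c m * r (w' m) := by
          rw [lt_inv_mul_iff₀ (by positivity)]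
          linarith [hrw m]
        rwa [max_eq_left (by linarith)] at this)
    refine false_of_unbounded_preimages hT hu' hpos' hlim' (w := fun m => c m • w' m) (fun m => ?_)
      (fun m => hp _) fun m x hx => ?_
    · rw [norm_smul, Real.norm_eq_abs, abs_of_pos (hc0 m)]
      have h1 : c m * ‖w' m‖ ≤ c m * R := mul_le_mul_of_nonneg_left (hw' m) (hc0 m).le
      have h2 : c m * R = 1 / ((m : ℝ) + 1) := by
        simp only [c]; field_simp
      linarith
    · rw [hpc]
      have := (le_max_right _ _).trans_lt (hθ m x hx)
      linarith

/-- Any `u` is the quotient of the bounded functions `u / (1 + |u|)` and `1 / (1 + |u|)`, and the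
denominator has nonzero limit by `hpos`. Limits along `G` thus form a character of `C(X, ℝ)`, an
evaluation by realcompactness; complete regularity turns this into convergence. -/
theorem exists_le_nhds_of_realcompact {X : Type*} [TopologicalSpace X] [CompletelyRegularSpace X]
    [RealcompactSpace X] {G : Filter X} [G.NeBot]
    (hG : ∀ a ∈ boundedContinuous X ℝ, ∃ r, Tendsto a G (𝓝 r))
    (hpos : ∀ a ∈ boundedContinuous X ℝ, (∀ x, 0 < a x) → ¬ Tendsto a G (𝓝 0)) :
    ∃ x, G ≤ 𝓝 x := by
  have hlim : ∀ u : C(X, ℝ), ∃ r, Tendsto u G (𝓝 r) := by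
    intro u
    have hd : ∀ x, 0 < 1 + |u x| := fun x => by positivity
    have hp : (fun x => (1 + |u x|)⁻¹) ∈ boundedContinuous X ℝ := by
      refine ⟨Continuous.inv₀ (by fun_prop) fun x => (hd x).ne', 1, fun x => ?_⟩
      rw [norm_inv, Real.norm_eq_abs, abs_of_pos (hd x)]
      exact inv_le_one_of_one_le₀ (by linarith [abs_nonneg (u x)])
    have hq : (fun x => u x * (1 + |u x|)⁻¹) ∈ boundedContinuous X ℝ := by
      refine ⟨u.continuous.mul hp.1, 1, fun x => ?_⟩
      rw [norm_mul, norm_inv, Real.norm_eq_abs, Real.norm_eq_abs, abs_of_pos (hd x),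
        ← div_eq_mul_inv, div_le_one (hd x)]
      linarith
    obtain ⟨r, hr⟩ := hG _ hp
    obtain ⟨s, hs⟩ := hG _ hq
    have hr0 : r ≠ 0 := by
      rintro rfl
      exact hpos _ hp (fun x => inv_pos.2 (hd x)) hr
    refine ⟨s / r, (hs.div hr hr0).congr fun x => ?_⟩
    have := (hd x).ne'
    change u x * (1 + |u x|)⁻¹ / (1 + |u x|)⁻¹ = u x
    field_simp
  choose φ hφ using hlim
  let Φ : C(X, ℝ) →ₐ[ℝ] ℝ :=
    { toFun := φ
      map_one' := tendsto_nhds_unique (hφ 1) tendsto_const_nhds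
      map_mul' := fun a b => tendsto_nhds_unique (hφ (a * b)) ((hφ a).mul (hφ b))
      map_zero' := tendsto_nhds_unique (hφ 0) tendsto_const_nhds
      map_add' := fun a b => tendsto_nhds_unique (hφ (a + b)) ((hφ a).add (hφ b))
      commutes' := fun c => tendsto_nhds_unique (hφ _) tendsto_const_nhds }
  obtain ⟨x, hx⟩ := RealcompactSpace.exists_eval Φ
  refine ⟨x, fun U hU => ?_⟩
  obtain ⟨O, hOU, hO, hxO⟩ := mem_nhds_iff.1 hU
  obtain ⟨f, hf, hfx, hf1⟩ := CompletelyRegularSpace.completely_regular x Oᶜ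
    hO.isClosed_compl (by simpa using hxO)
  let f' : C(X, ℝ) := ⟨fun z => f z, by fun_prop⟩
  have h1 : Tendsto f' G (𝓝 (f' x)) := by
    rw [← hx f']
    exact hφ f'
  have h2 : f' x < 1 := by simp [f', hfx]
  filter_upwards [h1.eventually_lt_const h2] with z hz
  refine hOU ?_
  by_contra hzO
  have : f z = 1 := hf1 hzO
  simp [f', this] at hz

end Bounded

/-! ### Strong continuity of `J`, and transfer to bundled function spaces -/

theorem IsRepresentedBy.isContinuousIntoContBij {𝕜 A B X Y E F : Type*} [RCLike 𝕜]
    [NormedAddCommGroup E] [NormedSpace 𝕜 E] [NormedAddCommGroup F] [NormedSpace 𝕜 F]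
    [FunLike A X E] [FunLike B Y F] [TopologicalSpace Y] {T : A → B} {h : Y → X}
    {J : Y → (E ≃ₗ[𝕜] F)}
    (hJ : IsRepresentedBy T h J) (hB : ∀ b : B, Continuous (b : Y → F)) {C : ℝ}
    (hA : ∀ e : E, ∃ a : A, (∀ x, a x = e) ∧ ∀ y, ‖T a y‖ ≤ C * ‖e‖) :
    IsContinuousIntoContBij J := by
  choose γ hγ hC using hA
  have hJγ : ∀ y e, J y e = T (γ e) y := fun y e => by rw [hJ, hγ]
  refine ⟨fun y => ⟨(J y : E →ₗ[𝕜] F).mkContinuous C fun e => ?_, (J y).bijective⟩,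
    fun y e => rfl, ?_⟩
  · rw [LinearEquiv.coe_coe, hJγ]
    exact hC e y
  · refine continuous_iInf_rng.2 fun e => continuous_induced_rng.2 ?_
    refine (hB (T (γ e))).congr fun y => ?_
    exact (hJγ y e).symm

section Transfer

variable {𝕜 A B X Y E F : Type*} [RCLike 𝕜]
  [NormedAddCommGroup E] [NormedSpace 𝕜 E] [NormedSpace ℝ E]
  [NormedAddCommGroup F] [NormedSpace 𝕜 F] [NormedSpace ℝ F]
  [AddCommGroup A] [Module 𝕜 A] [FunLike A X E] [AddCommGroup B] [Module 𝕜 B] [FunLike B Y F]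

/-- Forgets the bundling and the complex scalars, so that the real theory above applies to both
cases. -/
theorem IsBiseparating.exists_linearEquiv [IsScalarTower ℝ 𝕜 E]
    [IsScalarTower ℝ 𝕜 F] {V : Submodule ℝ (X → E)} {W : Submodule ℝ (Y → F)}
    {T : A →ₗ[𝕜] B} (hT : IsBiseparating T)
    (hA : ∀ a : A, (a : X → E) ∈ V) (hV : ∀ f ∈ V, ∃ a : A, (a : X → E) = f)
    (hB : ∀ b : B, (b : Y → F) ∈ W) (hW : ∀ g ∈ W, ∃ b : B, (b : Y → F) = g)
    (addA : ∀ (a a' : A) (x : X), (a + a') x = a x + a' x)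
    (smulA : ∀ (c : 𝕜) (a : A) (x : X), (c • a) x = c • a x)
    (addB : ∀ (b b' : B) (y : Y), (b + b') y = b y + b' y)
    (smulB : ∀ (c : 𝕜) (b : B) (y : Y), (c • b) y = c • b y) :
    ∃ T' : V ≃ₗ[ℝ] W, PreservesDisjointness T' ∧
      ∀ a : A, (T' ⟨a, hA a⟩ : Y → F) = (T a : Y → F) := by
  choose α hα using fun f : V => hV f f.2
  have hα' : ∀ a : A, α ⟨a, hA a⟩ = a := fun a => DFunLike.coe_injective (hα _)
  let L : V →ₗ[ℝ] W :=
    { toFun := fun f => ⟨T (α f), hB _⟩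
      map_add' := fun f g => by
        have : α (f + g) = α f + α g := DFunLike.coe_injective <| funext fun x => by
          rw [addA, hα, hα, hα]; rfl
        ext y
        simp [this, addB]
      map_smul' := fun c f => by
        have : α (c • f) = (c : 𝕜) • α f := DFunLike.coe_injective <| funext fun x => by
          rw [smulA, hα, hα, ← RCLike.real_smul_eq_coe_smul (K := 𝕜)]; rfl
        ext y
        change T (α (c • f)) y = c • T (α f) y
        rw [this, map_smul, smulB, ← RCLike.real_smul_eq_coe_smul (K := 𝕜)] }
  have hL : ∀ f, (L f : Y → F) = T (α f) := fun f => rfl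
  have hbij : Bijective L := by
    refine ⟨fun f g hfg => ?_, fun g => ?_⟩
    · have h1 : α f = α g := hT.bijective.1
        (DFunLike.coe_injective (congrArg (fun g : W => (g : Y → F)) hfg))
      exact Subtype.ext (by rw [← hα f, ← hα g, h1])
    · obtain ⟨b, hb⟩ := hW g g.2
      obtain ⟨a, rfl⟩ := hT.bijective.2 b
      exact ⟨⟨a, hA a⟩, Subtype.ext (by rw [hL, hα', hb])⟩
  refine ⟨LinearEquiv.ofBijective L hbij, fun f g => ?_, fun a => ?_⟩
  · simp only [LinearEquiv.ofBijective_apply, hL]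
    rw [← hα f, ← hα g]
    refine ⟨hT.separating.disjoint _ _, fun h => ?_⟩
    have := hT.inverse_separating.disjoint _ _ h
    simpa only [Equiv.ofBijective_symm_apply_apply] using this
  · rw [LinearEquiv.ofBijective_apply, hL, hα']

variable [TopologicalSpace X] [TopologicalSpace Y]

theorem exists_isRepresentedBy [Nontrivial E] [Nontrivial F] {V : Submodule ℝ (X → E)}
    {W : Submodule ℝ (Y → F)} {M : Set (X → ℝ)} {N : Set (Y → ℝ)}
    (hV : IsFunctionModule V M) (hW : IsFunctionModule W N)
    {T' : V ≃ₗ[ℝ] W} (hT' : PreservesDisjointness T') {T : A →ₗ[𝕜] B} (hT : Surjective T)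
    (hA : ∀ a : A, (a : X → E) ∈ V) (hVA : ∀ f ∈ V, ∃ a : A, (a : X → E) = f)
    (hWB : ∀ g ∈ W, ∃ b : B, (b : Y → F) = g)
    (hTT' : ∀ a : A, (T' ⟨a, hA a⟩ : Y → F) = (T a : Y → F))
    (addA : ∀ (a a' : A) (x : X), (a + a') x = a x + a' x)
    (smulA : ∀ (c : 𝕜) (a : A) (x : X), (c • a) x = c • a x)
    (addB : ∀ (b b' : B) (y : Y), (b + b') y = b y + b' y)
    (smulB : ∀ (c : 𝕜) (b : B) (y : Y), (c • b) y = c • b y)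
    {h : Y → X} {k : X → Y}
    (hh : ∀ y, germFilter T' y ≤ 𝓝 (h y)) (hk : ∀ x, germFilter T'.symm x ≤ 𝓝 (k x))
    (hkh : LeftInverse k h) (hNM : ∀ a ∈ N, a ∘ k ∈ M) {C : ℝ}
    (hC : ∀ (a : A) (r : ℝ), 0 ≤ r → (∀ x, ‖a x‖ ≤ r) → ∀ y, ‖T a y‖ ≤ C * r) :
    ∃ J : Y → (E ≃ₗ[𝕜] F), IsRepresentedBy T h J := by
  have hC' : ∀ (f : V) (r : ℝ), 0 ≤ r → (∀ x, ‖(f : X → E) x‖ ≤ r) →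
      ∀ y, ‖(T' f : Y → F) y‖ ≤ C * r := by
    rintro ⟨f, hf⟩ r hr hfr y
    obtain ⟨a, rfl⟩ := hVA f hf
    rw [hTT']
    exact hC a r hr hfr y
  choose γ hγ using fun e : E => hVA _ (hV.const_mem e)
  have hrep : ∀ (a : A) (y : Y), T a y = T (γ (a (h y))) y := by
    intro a y
    rw [← hTT', ← hTT']
    exact map_eq_map_of_bounded hV hW hT' hh hC' (by simp [hγ])
  let L : Y → (E →ₗ[𝕜] F) := fun y =>
    { toFun := fun e => T (γ e) y
      map_add' := fun e e' => by
        have : γ (e + e') = γ e + γ e' := DFunLike.coe_injective <| funext fun x => by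
          rw [addA, hγ, hγ, hγ]
        rw [this, map_add, addB]
      map_smul' := fun c e => by
        have : γ (c • e) = c • γ e := DFunLike.coe_injective <| funext fun x => by
          rw [smulA, hγ, hγ]
        rw [this, map_smul, smulB, RingHom.id_apply] }
  have hL : ∀ y, Bijective (L y) := by
    refine fun y => ⟨(injective_iff_map_eq_zero _).2 fun e he => ?_, fun w => ?_⟩
    · refine eq_zero_of_map_const_eq_zero hV hW hT' hh hk hkh hNM hC' (y₀ := y) ?_
      have h1 : (⟨_, hV.const_mem e⟩ : V) = ⟨γ e, hA _⟩ := Subtype.ext (hγ e).symm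
      rw [h1, hTT']
      exact he
    · obtain ⟨b, hb⟩ := hWB _ (hW.const_mem w)
      obtain ⟨a, rfl⟩ := hT b
      exact ⟨a (h y), by rw [← congrFun hb y, hrep a y]; rfl⟩
  exact ⟨fun y => LinearEquiv.ofBijective (L y) (hL y), hrep⟩

end Transfer

theorem nontrivial_of_not_finiteDimensional {𝕜 E : Type*} [RCLike 𝕜] [NormedAddCommGroup E]
    [NormedSpace 𝕜 E] (h : ¬ FiniteDimensional 𝕜 E) : Nontrivial E := by
  by_contra hn
  have := not_nontrivial_iff_subsingleton.1 hn
  exact h inferInstance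

/-! ### The two cases of the theorem -/

section Main

variable {𝕜 E F : Type*} [RCLike 𝕜] [NormedAddCommGroup E] [NormedSpace 𝕜 E]
  [NormedAddCommGroup F] [NormedSpace 𝕜 F]

theorem exists_homeomorph_isRepresentedBy {X Y : Type*} [TopologicalSpace X] [T35Space X]
    [RealcompactSpace X] [TopologicalSpace Y] [T35Space Y] [RealcompactSpace Y]
    (hE : ¬ FiniteDimensional 𝕜 E) (hF : ¬ FiniteDimensional 𝕜 F)
    (T : (X →ᵇ E) →L[𝕜] (Y →ᵇ F)) (hT : IsBiseparating T) :
    ∃ (h : Y ≃ₜ X) (J : Y → (E ≃ₗ[𝕜] F)), IsRepresentedBy T h J := by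
  let : NormedSpace ℝ E := NormedSpace.restrictScalars ℝ 𝕜 E
  let : NormedSpace ℝ F := NormedSpace.restrictScalars ℝ 𝕜 F
  have : IsScalarTower ℝ 𝕜 E := RestrictScalars.isScalarTower ℝ 𝕜 E
  have : IsScalarTower ℝ 𝕜 F := RestrictScalars.isScalarTower ℝ 𝕜 F
  have := nontrivial_of_not_finiteDimensional hE
  have := nontrivial_of_not_finiteDimensional hF
  have hV := isFunctionModule_boundedContinuous X E
  have hW := isFunctionModule_boundedContinuous Y F
  have hA : ∀ a : X →ᵇ E, (a : X → E) ∈ boundedContinuous X E :=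
    fun a => ⟨a.continuous, ‖a‖, a.norm_coe_le_norm⟩
  have hB : ∀ b : Y →ᵇ F, (b : Y → F) ∈ boundedContinuous Y F :=
    fun b => ⟨b.continuous, ‖b‖, b.norm_coe_le_norm⟩
  have hVA : ∀ f ∈ boundedContinuous X E, ∃ a : X →ᵇ E, (a : X → E) = f := by
    rintro f ⟨hf, C, hC⟩
    exact ⟨BoundedContinuousFunction.ofNormedAddCommGroup f hf C hC, rfl⟩
  have hWB : ∀ f ∈ boundedContinuous Y F, ∃ a : Y →ᵇ F, (a : Y → F) = f := by
    rintro f ⟨hf, C, hC⟩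
    exact ⟨BoundedContinuousFunction.ofNormedAddCommGroup f hf C hC, rfl⟩
  obtain ⟨T', hT', hTT'⟩ := IsBiseparating.exists_linearEquiv (T := T.toLinearMap) hT hA hVA hB hWB
    (fun _ _ _ => rfl) (fun _ _ _ => rfl) (fun _ _ _ => rfl) (fun _ _ _ => rfl)
  -- Beyond nontriviality, infinite dimension is used only through the bounded `1`-separated
  -- sequence of Riesz's lemma: in `F` for `T'`, in `E` for its inverse.
  have hh : ∀ y, ∃ x, germFilter T' y ≤ 𝓝 x := fun y => by
    have := germFilter_neBot hW T' y
    exact exists_le_nhds_of_realcompact (fun a ha => exists_tendsto_germFilter hV hW hT' y ha)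
      fun a ha hpos => not_tendsto_germFilter_zero hT' (exists_seq_norm_le_one_le_norm_sub hF)
        ha hpos y
  have hk : ∀ x, ∃ y, germFilter T'.symm x ≤ 𝓝 y := fun x => by
    have := germFilter_neBot hV T'.symm x
    exact exists_le_nhds_of_realcompact
      (fun a ha => exists_tendsto_germFilter hW hV hT'.symm x ha)
      fun a ha hpos => not_tendsto_germFilter_zero hT'.symm
        (exists_seq_norm_le_one_le_norm_sub hE) ha hpos x
  choose h hh using hh
  choose k hk using hk
  have hhc := continuous_of_germFilter_le hW hh
  have hkc := continuous_of_germFilter_le hV hk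
  have hkh := leftInverse_of_germFilter_le hV hW hT' hh hk hkc
  have hhk := leftInverse_of_germFilter_le hW hV hT'.symm hk hh hhc
  obtain ⟨J, hJ⟩ := exists_isRepresentedBy hV hW hT' (T := T.toLinearMap) hT.bijective.2 hA hVA hWB
    hTT' (fun _ _ _ => rfl) (fun _ _ _ => rfl) (fun _ _ _ => rfl) (fun _ _ _ => rfl) hh hk hkh
    (fun a ha => ⟨ha.1.comp hkc, ha.2.imp fun C hC x => hC (k x)⟩) (C := ‖T‖)
    fun a r hr har y => (BoundedContinuousFunction.norm_coe_le_norm (T a) y).trans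
      (T.le_opNorm_of_le ((BoundedContinuousFunction.norm_le hr).2 har))
  exact ⟨⟨⟨h, k, hkh, hhk⟩, hhc, hkc⟩, J, hJ⟩

theorem exists_uniformEquiv_isRepresentedBy {X Y : Type*} [MetricSpace X] [CompleteSpace X]
    [MetricSpace Y] [CompleteSpace Y] [Nontrivial E] [Nontrivial F]
    (T : BddUniformCont 𝕜 X E →L[𝕜] BddUniformCont 𝕜 Y F) (hT : IsBiseparating T) :
    ∃ (h : Y ≃ᵤ X) (J : Y → (E ≃ₗ[𝕜] F)), IsRepresentedBy T h J := by
  let : NormedSpace ℝ E := NormedSpace.restrictScalars ℝ 𝕜 E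
  let : NormedSpace ℝ F := NormedSpace.restrictScalars ℝ 𝕜 F
  have : IsScalarTower ℝ 𝕜 E := RestrictScalars.isScalarTower ℝ 𝕜 E
  have : IsScalarTower ℝ 𝕜 F := RestrictScalars.isScalarTower ℝ 𝕜 F
  have hV := isFunctionModule_boundedUniform X E
  have hW := isFunctionModule_boundedUniform Y F
  have hA : ∀ a : BddUniformCont 𝕜 X E, (a : X → E) ∈ boundedUniform X E :=
    fun a => ⟨a.2, ‖a.1‖, a.1.norm_coe_le_norm⟩
  have hB : ∀ b : BddUniformCont 𝕜 Y F, (b : Y → F) ∈ boundedUniform Y F :=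
    fun b => ⟨b.2, ‖b.1‖, b.1.norm_coe_le_norm⟩
  have hVA : ∀ f ∈ boundedUniform X E, ∃ a : BddUniformCont 𝕜 X E, (a : X → E) = f := by
    rintro f ⟨hf, C, hC⟩
    exact ⟨⟨BoundedContinuousFunction.ofNormedAddCommGroup f hf.continuous C hC, hf⟩, rfl⟩
  have hWB : ∀ f ∈ boundedUniform Y F, ∃ a : BddUniformCont 𝕜 Y F, (a : Y → F) = f := by
    rintro f ⟨hf, C, hC⟩
    exact ⟨⟨BoundedContinuousFunction.ofNormedAddCommGroup f hf.continuous C hC, hf⟩, rfl⟩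
  obtain ⟨T', hT', hTT'⟩ := IsBiseparating.exists_linearEquiv (T := T.toLinearMap) hT hA hVA hB hWB
    (fun _ _ _ => rfl) (fun _ _ _ => rfl) (fun _ _ _ => rfl) (fun _ _ _ => rfl)
  have hh : ∀ y, ∃ x, germFilter T' y ≤ 𝓝 x := fun y => by
    have := germFilter_neBot hW T' y
    have := isCountablyGenerated_germFilter T' y
    exact exists_le_nhds_of_forall_tendsto fun a ha => exists_tendsto_germFilter hV hW hT' y ha
  have hk : ∀ x, ∃ y, germFilter T'.symm x ≤ 𝓝 y := fun x => by
    have := germFilter_neBot hV T'.symm x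
    have := isCountablyGenerated_germFilter T'.symm x
    exact exists_le_nhds_of_forall_tendsto fun a ha =>
      exists_tendsto_germFilter hW hV hT'.symm x ha
  choose h hh using hh
  choose k hk using hk
  have hhc := uniformContinuous_of_germFilter_le hT' hh
  have hkc := uniformContinuous_of_germFilter_le hT'.symm hk
  have hkh := leftInverse_of_germFilter_le hV hW hT' hh hk hkc.continuous
  have hhk := leftInverse_of_germFilter_le hW hV hT'.symm hk hh hhc.continuous
  obtain ⟨J, hJ⟩ := exists_isRepresentedBy hV hW hT' (T := T.toLinearMap) hT.bijective.2 hA hVA hWB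
    hTT' (fun _ _ _ => rfl) (fun _ _ _ => rfl) (fun _ _ _ => rfl) (fun _ _ _ => rfl) hh hk hkh
    (fun a ha => ⟨ha.1.comp hkc, ha.2.imp fun C hC x => hC (k x)⟩) (C := ‖T‖)
    fun a r hr har y => (BoundedContinuousFunction.norm_coe_le_norm (T a).1 y).trans
      (T.le_opNorm_of_le ((BoundedContinuousFunction.norm_le (f := a.1) hr).2 har))
  exact ⟨⟨⟨h, k, hkh, hhk⟩, hhc, hkc⟩, J, hJ⟩

end Main

theorem corollary2p9 {𝕜 E F : Type*} [RCLike 𝕜]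
    [NormedAddCommGroup E] [NormedSpace 𝕜 E] [NormedAddCommGroup F] [NormedSpace 𝕜 F] :
    (∀ (X Y : Type*) [TopologicalSpace X] [T35Space X] [RealcompactSpace X]
        [TopologicalSpace Y] [T35Space Y] [RealcompactSpace Y],
        ¬ FiniteDimensional 𝕜 E → ¬ FiniteDimensional 𝕜 F →
        ∀ T : (X →ᵇ E) →L[𝕜] (Y →ᵇ F), IsBiseparating T →
          (∃ (h : Y ≃ₜ X) (J : Y → (E ≃ₗ[𝕜] F)), IsRepresentedBy T h J) ∧
          (∀ (h : Y ≃ₜ X) (J : Y → (E ≃ₗ[𝕜] F)), IsRepresentedBy T h J →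
            IsContinuousIntoContBij J)) ∧
    (∀ (X Y : Type*) [MetricSpace X] [CompleteSpace X] [MetricSpace Y] [CompleteSpace Y],
        Nontrivial E → Nontrivial F →
        ∀ T : BddUniformCont 𝕜 X E →L[𝕜] BddUniformCont 𝕜 Y F, IsBiseparating T →
          (∃ (h : Y ≃ᵤ X) (J : Y → (E ≃ₗ[𝕜] F)), IsRepresentedBy T h J) ∧
          (∀ (h : Y ≃ₜ X) (J : Y → (E ≃ₗ[𝕜] F)), IsRepresentedBy T h J →
            IsContinuousIntoContBij J)) := by
  refine ⟨fun X Y _ _ _ _ _ _ hE hF T hT =>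
    ⟨exists_homeomorph_isRepresentedBy hE hF T hT, fun h J hJ => ?_⟩,
    fun X Y _ _ _ _ _ _ T hT =>
    ⟨exists_uniformEquiv_isRepresentedBy T hT, fun h J hJ => ?_⟩⟩
  · refine hJ.isContinuousIntoContBij (fun b => b.continuous) (C := ‖T‖) fun e =>
      ⟨BoundedContinuousFunction.const X e, fun _ => rfl, fun y => ?_⟩
    exact (BoundedContinuousFunction.norm_coe_le_norm _ y).trans
      (T.le_opNorm_of_le (BoundedContinuousFunction.norm_const_le e))
  · refine hJ.isContinuousIntoContBij (fun b => b.1.continuous) (C := ‖T‖) fun e =>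
      ⟨⟨BoundedContinuousFunction.const X e, uniformContinuous_const⟩, fun _ => rfl, fun y => ?_⟩
    exact (BoundedContinuousFunction.norm_coe_le_norm (T _).1 y).trans
      (T.le_opNorm_of_le (BoundedContinuousFunction.norm_const_le e))
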